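/- **Model.** A quantum switch serves $K$ users in slotted time. In every slot, on each link $i$, $\alpha_{\max}$ independent attempts to create a link-level entanglement are made, each successful with probability $p_i\in[0,1]$. The $x$ entanglements obtained on a link are purified; this leaves $y\le x$ purified ones with probability $P_{Y|X}(y\mid x)$, where $P_{Y|X}$ is an arbitrary conditional yield distribution with $y\le x$. So the number $\tilde T_i(n)$ of purified entanglements on link $i$ in slot $n$ has the law $P_{\tilde T_i}(\tilde a)=\sum_{a\ge\tilde a}^{\alpha_{\max}}P_{Y|X}(\tilde a\mid a)\binom{\alpha_{\max}}{a}p_i^a(1-p_i)^{\alpha_{\max}-a}$, independently over links and slots; let $P_{\tilde T}(\tilde a)=\prod_iP_{\tilde T_i}(\tilde a_i)$ for $\tilde a\in\mathcal A=\{0,\dots,\alpha_{\max}\}^K$. Requests for the pairs $i<j$ arrive in numbers $A_{ij}(n)$ that are i.i.d. over $n$, independent over pairs, with mean $\lambda_{ij}$. For availability $\tilde a$, a schedule $\pi=(\pi_{ij})_{i<j}$ of non-negative integers (with $\pi_{ji}=\pi_{ij}$) is feasible if $\sum_i\pi_{ij}\le\tilde a_j$ for all $j$. In slot $n$ a policy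 chooses, from the queue lengths $\tilde Q(n)$ and from $\tilde T(n)=\tilde a$, a feasible schedule $\tilde W(n)$; then $\min\{\tilde W_{ij}(n),\tilde Q_{ij}(n)\}$ swaps are attempted for each pair, each of them succeeding independently with probability $q_{ij}$ and serving one request; with $\tilde D_{ij}(n)$ the number of successes, $\tilde Q(n+1)=\tilde Q(n)-\tilde D(n)+A(n)$. The switch is stable if $\tilde Q(n)$ converges in distribution, for every initial law, to one and the same limit $\tilde Q$ with $\mathbb E[\tilde Q]<\infty$. The policy MW-PS chooses $\tilde W(n)\in\arg\max_\pi\sum_{i<j}\pi_{ij}q_{ij}\tilde Q_{ij}(n)$ over the feasible schedules $\pi$, with ties broken in any (possibly random) way depending on $\tilde Q(n)$ and $\tilde T(n)$. Let $\Lambda^{PS}$ be the set of all rate vectors $\lambda\ge0$ for which there are weights $b_{\tilde a,\pi}>0$ ($\tilde a\in\mathcal A$, $\pi$ feasible for $\tilde a$) with $\sum_\pi b_{\tilde a,\pi}<1$ for all $\tilde a\in\mathcal A$ and, for all $i<j$, $$\lambda_{ij}\le\sum_{\tilde a\in\mathcal A,\ \tilde a\ne0}P_{\tilde T}(\tilde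 a)\sum_{\pi\text{ feasible for }\tilde a}b_{\tilde a,\pi}\,q_{ij}\pi_{ij}.$$ **Theorem.** Suppose that $q_{ij}>0$ for all $i<j$ and $P_{\tilde T_i}(0)<1$ for all $i$. Call arrivals admissible if $\mathbb E[A_{ij}(n)^2]<\infty$ for all $i<j$ and the Markov chain $\tilde Q(n)$ under MW-PS is irreducible and aperiodic, in the sense that some state can be reached from every state at all sufficiently late times. Then, for all admissible arrivals with rate vector $\lambda$, the switch is stable under MW-PS if and only if $\lambda\in\Lambda^{PS}$. So the capacity region of MW-PS, i.e. the set of rate vectors $\lambda$ such that MW-PS stabilizes the switch for all admissible arrivals with rate vector $\lambda$, coincides with $\Lambda^{PS}$. The irreducibility and aperiodicity condition holds in particular whenever $\Pr[A_{ij}(n)=0]>0$ for all $i<j$. -/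

import Mathlib

open MeasureTheory ProbabilityTheory Filter Topology
open scoped NNReal ENNReal BigOperators

noncomputable section

namespace QSwitch

/-! ### Discrete laws -/

/-- The joint law of finitely many independent natural-number valued variables. -/
def indepLaw {ι : Type*} [Fintype ι] (P : ι → PMF ℕ) : PMF (ι → ℕ) :=
  (Measure.pi fun i => (P i).toMeasure).toPMF

theorem indepLaw_apply {ι : Type*} [Fintype ι] (P : ι → PMF ℕ) (x : ι → ℕ) :
    indepLaw P x = ∏ i, P i (x i) := by
  rw [indepLaw, Measure.toPMF_apply, Measure.pi_singleton]
  exact Finset.prod_congr rfl fun i _ =>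
    PMF.toMeasure_apply_singleton _ _ (measurableSet_singleton _)

/-- The binomial law with `n` trials and success probability `p`. -/
def binomialLaw (n : ℕ) (p : unitInterval) : PMF ℕ :=
  (ProbabilityTheory.binomial n p).toPMF

/-! ### Markov chains on a countable state space -/

/-- The law at time `n` of the Markov chain with transition kernel `P` and initial law `ν`. -/
def lawAt {S : Type*} (P : S → PMF S) (ν : PMF S) : ℕ → PMF S
  | 0 => ν
  | n + 1 => (lawAt P ν n).bind P

/-- Irreducibility and aperiodicity: some state `y` can be reached from every state, and it can be
reached at all sufficiently late times. So there is exactly one closed communicating class,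
it is aperiodic, and all states outside of it (transient ones) lead into it. If the chain is
irreducible on the whole of `S`, this is the usual notion of an irreducible aperiodic chain. -/
def IrreducibleAperiodic {S : Type*} (P : S → PMF S) : Prop :=
  ∃ y : S, ∀ x : S, ∀ᶠ n in atTop, 0 < lawAt P (PMF.pure x) n y

/-! ### The switch -/

/-- The (unordered) pairs of users, written `(i, j)` with `i < j`. -/
abbrev Pair (K : ℕ) : Type := {e : Fin K × Fin K // e.1 < e.2}

/-- A vector of natural numbers indexed by the pairs of users: queue lengths, schedules, arrivals
and departures. -/
abbrev PairVec (K : ℕ) : Type := Pair K → ℕ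

/-- The link `j` is used by the pair `e`. -/
def Touches {K : ℕ} (e : Pair K) (j : Fin K) : Prop := e.1.1 = j ∨ e.1.2 = j

instance {K : ℕ} (e : Pair K) (j : Fin K) : Decidable (Touches e j) := by
  unfold Touches; infer_instance

/-- The parameters of the switch with `K` users under the purify-and-swap architecture. -/
structure Switch (K : ℕ) where
  /-- number of link-level generation attempts per link and slot -/
  attempts : ℕ
  /-- success probability of a link-level generation attempt -/
  p : Fin K → unitInterval
  /-- success probability of an entanglement swap -/
  q : Pair K → unitInterval
  /-- conditional yield law of the purification protocol, given the number of input pairs -/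
  yieldLaw : ℕ → PMF ℕ
  /-- purification does not create more pairs than it consumes -/
  yield_le : ∀ x y : ℕ, yieldLaw x y ≠ 0 → y ≤ x

namespace Switch

variable {K : ℕ} (M : Switch K)

/-- The law of the number of purified link-level entanglements of link `i` in a slot. -/
def purifiedLaw (i : Fin K) : PMF ℕ :=
  (binomialLaw M.attempts (M.p i)).bind M.yieldLaw

/-- The joint law of the numbers of purified link-level entanglements of all links in a slot. -/
def availLaw : PMF (Fin K → ℕ) := indepLaw M.purifiedLaw

/-- The set of possible vectors of numbers of available link-level entanglements. -/
def availStates : Finset (Fin K → ℕ) :=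
  Fintype.piFinset fun _ => Finset.range (M.attempts + 1)

end Switch

/-- The schedules `π` that are feasible when `a j` purified entanglements are available on link `j`:
for every link `j`, at most `a j` entanglements are used. -/
def feasible {K : ℕ} (a : Fin K → ℕ) : Finset (PairVec K) :=
  {π ∈ Fintype.piFinset fun e : Pair K => Finset.range (a e.1.1 + 1) |
    ∀ j, ∑ e with Touches e j, π e ≤ a j}

theorem mem_feasible {K : ℕ} (a : Fin K → ℕ) (π : PairVec K) :
    π ∈ feasible a ↔ ∀ j, ∑ e with Touches e j, π e ≤ a j := by
  simp only [feasible, Finset.mem_filter, Fintype.mem_piFinset, Finset.mem_range,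
    and_iff_right_iff_imp]
  intro h e
  have h1 := Finset.single_le_sum (f := π) (s := {e' : Pair K | Touches e' e.1.1})
    (fun _ _ => Nat.zero_le _) (a := e)
    (Finset.mem_filter.2 ⟨Finset.mem_univ _, Or.inl rfl⟩)
  have h2 := h e.1.1
  omega

/-- A (possibly randomized) scheduling policy: the law of the schedule, given the queue lengths and
the numbers of available purified link-level entanglements. -/
abbrev Policy (K : ℕ) : Type := PairVec K → (Fin K → ℕ) → PMF (PairVec K)

/-- The policy is a max-weight policy: for queue lengths `x` and availability `a` it
only uses schedules that maximize `∑ π_e q_e x_e` over the feasible schedules `π`.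
Ties are broken in an arbitrary way. -/
def IsMaxWeight {K : ℕ} (M : Switch K) (W : Policy K) : Prop :=
  ∀ (x : PairVec K) (a : Fin K → ℕ), ∀ w ∈ (W x a).support,
    w ∈ feasible a ∧ ∀ π ∈ feasible a,
      ∑ e, (π e : ℝ) * (M.q e : ℝ) * (x e : ℝ) ≤ ∑ e, (w e : ℝ) * (M.q e : ℝ) * (x e : ℝ)

/-- The transition kernel of the vector of queue lengths, for arrivals that are independent over
slots and pairs, `A e` being the law of the number of arrivals for the pair `e` in a slot.
Given queue lengths `x`, available entanglements are drawn, the policy chooses `w`,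
`min (w e) (x e)` swaps are attempted for the pair `e`, each of them succeeds with probability
`q e` and then serves one request, and new requests arrive. (The number `d e` of
successful swaps never exceeds `x e`.) -/
def queueStep {K : ℕ} (M : Switch K) (W : Policy K) (A : Pair K → PMF ℕ) (x : PairVec K) :
    PMF (PairVec K) :=
  M.availLaw.bind fun a =>
    (W x a).bind fun w =>
      (indepLaw fun e => binomialLaw (min (w e) (x e)) (M.q e)).bind fun d =>
        (indepLaw A).map fun n e => x e - d e + n e

/-- The law of the queue lengths at time `n`, as a probability measure. -/
def queueLaw {K : ℕ} (M : Switch K) (W : Policy K) (A : Pair K → PMF ℕ) (ν : PMF (PairVec K))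
    (n : ℕ) : ProbabilityMeasure (PairVec K) :=
  ⟨(lawAt (queueStep M W A) ν n).toMeasure, inferInstance⟩

/-- Stability: whatever the initial law `ν`, the queue lengths converge in distribution to the same
limit, and this limit has finite expectation. -/
def Stable {K : ℕ} (M : Switch K) (W : Policy K) (A : Pair K → PMF ℕ) : Prop :=
  ∃ Q : ProbabilityMeasure (PairVec K),
    (∀ ν : PMF (PairVec K), Tendsto (queueLaw M W A ν) atTop (𝓝 Q)) ∧
    ∀ e, Integrable (fun x : PairVec K => (x e : ℝ)) (Q : Measure (PairVec K))

/-- The numbers of arrivals per slot have finite second moments. -/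
def FiniteSecondMoments {K : ℕ} (A : Pair K → PMF ℕ) : Prop :=
  ∀ e, MemLp (fun k : ℕ => (k : ℝ)) 2 (A e).toMeasure

/-- The arrivals have rate vector `lam`. -/
def HasRates {K : ℕ} (A : Pair K → PMF ℕ) (lam : Pair K → ℝ≥0) : Prop :=
  ∀ e, Integrable (fun k : ℕ => (k : ℝ)) (A e).toMeasure ∧
    ∫ k : ℕ, (k : ℝ) ∂(A e).toMeasure = lam e

/-- Arrivals that are considered: finite second moments, and the queue lengths under the policy
form an irreducible aperiodic Markov chain. -/
def Admissible {K : ℕ} (M : Switch K) (W : Policy K) (A : Pair K → PMF ℕ) : Prop :=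
  FiniteSecondMoments A ∧ IrreducibleAperiodic (queueStep M W A)

/-- The capacity region of a policy: the rate vectors for which it stabilizes the switch. -/
def capacityRegion {K : ℕ} (M : Switch K) (W : Policy K) : Set (Pair K → ℝ≥0) :=
  {lam | ∀ A : Pair K → PMF ℕ, HasRates A lam → Admissible M W A → Stable M W A}

/-- The region `Λ^PS`: rate vectors dominated by
`∑_{a ≠ 0} P(a) ∑_{π feasible for a} b_{a,π} q π` for some weights `b_{a,π} > 0` with
`∑_π b_{a,π} < 1` for all `a`. -/
def LambdaPS {K : ℕ} (M : Switch K) : Set (Pair K → ℝ≥0) :=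
  {lam | ∃ b : (Fin K → ℕ) → PairVec K → ℝ,
    (∀ a ∈ M.availStates, (∀ π ∈ feasible a, 0 < b a π) ∧ ∑ π ∈ feasible a, b a π < 1) ∧
    ∀ e, (lam e : ℝ) ≤ ∑ a ∈ M.availStates with a ≠ 0,
      (M.availLaw a).toReal * ∑ π ∈ feasible a, b a π * ((M.q e : ℝ) * (π e : ℝ))}

end QSwitch

end

/-! Both directions rest on the support function of the rate region: `meanWeight M c` is the mean
over the availability of the largest weight `∑ π q c` of a feasible schedule.

Sufficiency. Total scheduling weights below 1 leave a uniform slack, `∑ c λ + ε ∑ c ≤ meanWeight M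
c` for all `c ≥ 0` (`exists_slack_of_mem_LambdaPS`). Max-weight scheduling attains the maximum for
`c = x`, up to a bounded loss from short queues, so the quadratic function `∑ x²` has drift at most
`B - 2ε ∑ x` (`drift_queueStep`). Ergodicity follows from this drift without return times or
couplings (`Drift.ergodic`). A limit of Cesàro averages along an ultrafilter is a stationary law,
and the drift keeps its mass from escaping. For convergence, the limsup of the gap between the
expectations from two starting points is subharmonic for two independent copies of the chain. A
maximum principle places its supremum in a finite set, and reachability of a common state carries
this supremum to the diagonal, where the function vanishes.

Necessity. Outside `Λ^PS`, Hahn–Banach gives a nonzero `c ≥ 0` with `meanWeight M c ≤ ∑ c λ`, so `∑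
c x` is a submartingale. Equality is possible, hence positive drift cannot be used. But a stationary
law with finite mean forces `∑ c x` to be conserved, which makes weighted arrivals and departures
deterministic and equal. Pairs with `c > 0` and `q < 1` then have neither service nor arrivals, and
the functional restricted to the pairs with `q = 1` can never decrease from any state. It remains
nonzero, which contradicts the existence of a state reachable from everywhere
(`mem_LambdaPS_of_stable`). -/

noncomputable section

namespace QSwitch

/-! ### Expectations of nonnegative functions under discrete laws -/

section Expect

variable {α β : Type*}

/-- The expectation of a nonnegative function under a discrete law. -/
def expect (p : PMF α) (f : α → ℝ≥0∞) : ℝ≥0∞ := ∑' a, p a * f a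

theorem expect_pure (a : α) (f : α → ℝ≥0∞) : expect (PMF.pure a) f = f a := by
  classical
  rw [expect, tsum_eq_single a]
  · simp
  · intro b hb
    simp [PMF.pure_apply, hb]

theorem expect_bind (p : PMF α) (k : α → PMF β) (f : β → ℝ≥0∞) :
    expect (p.bind k) f = expect p fun a => expect (k a) f := by
  simp only [expect, PMF.bind_apply, ← ENNReal.tsum_mul_right, ← ENNReal.tsum_mul_left]
  rw [ENNReal.tsum_comm]
  simp only [mul_assoc]

theorem expect_map (p : PMF α) (g : α → β) (f : β → ℝ≥0∞) :
    expect (p.map g) f = expect p (f ∘ g) := by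
  rw [PMF.map, expect_bind]
  simp only [Function.comp_apply, expect_pure]
  rfl

theorem expect_const (p : PMF α) (c : ℝ≥0∞) : expect p (fun _ => c) = c := by
  rw [expect, ENNReal.tsum_mul_right, p.tsum_coe, one_mul]

theorem expect_add (p : PMF α) (f g : α → ℝ≥0∞) :
    expect p (fun a => f a + g a) = expect p f + expect p g := by
  simp only [expect, mul_add, ENNReal.tsum_add]

theorem expect_const_mul (p : PMF α) (c : ℝ≥0∞) (f : α → ℝ≥0∞) :
    expect p (fun a => c * f a) = c * expect p f := by
  simp only [expect, mul_left_comm _ c, ENNReal.tsum_mul_left]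

theorem expect_finset_sum {ι : Type*} (p : PMF α) (s : Finset ι) (f : ι → α → ℝ≥0∞) :
    expect p (fun a => ∑ i ∈ s, f i a) = ∑ i ∈ s, expect p (f i) := by
  classical
  induction s using Finset.induction_on with
  | empty => simp [expect]
  | insert i s hi ih => simp only [Finset.sum_insert hi, expect_add, ih]

theorem expect_mono_of_support {p : PMF α} {f g : α → ℝ≥0∞} (h : ∀ a ∈ p.support, f a ≤ g a) :
    expect p f ≤ expect p g := by
  refine ENNReal.tsum_le_tsum fun a => ?_
  by_cases ha : p a = 0
  · simp [ha]
  · gcongr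
    exact h a ha

theorem expect_mono {p : PMF α} {f g : α → ℝ≥0∞} (h : ∀ a, f a ≤ g a) :
    expect p f ≤ expect p g :=
  expect_mono_of_support fun a _ => h a

theorem expect_congr_of_support {p : PMF α} {f g : α → ℝ≥0∞} (h : ∀ a ∈ p.support, f a = g a) :
    expect p f = expect p g :=
  le_antisymm (expect_mono_of_support fun a ha => (h a ha).le)
    (expect_mono_of_support fun a ha => (h a ha).ge)

theorem expect_le_of_le {p : PMF α} {f : α → ℝ≥0∞} {c : ℝ≥0∞} (h : ∀ a ∈ p.support, f a ≤ c) :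
    expect p f ≤ c :=
  (expect_mono_of_support h).trans_eq (expect_const p c)

theorem mul_le_expect (p : PMF α) (f : α → ℝ≥0∞) (a : α) : p a * f a ≤ expect p f :=
  ENNReal.le_tsum a

theorem expect_eq_zero_iff {p : PMF α} {f : α → ℝ≥0∞} :
    expect p f = 0 ↔ ∀ a ∈ p.support, f a = 0 := by
  simp only [expect, ENNReal.tsum_eq_zero, mul_eq_zero, PMF.mem_support_iff]
  exact forall_congr' fun a => by tauto

theorem ne_top_of_expect_ne_top {p : PMF α} {f : α → ℝ≥0∞} (h : expect p f ≠ ∞) {a : α}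
    (ha : a ∈ p.support) : f a ≠ ∞ := by
  intro hf
  refine h (top_le_iff.1 ((mul_le_expect p f a).trans' ?_))
  rw [hf, ENNReal.mul_top ha]

/-- If `f ≤ g` and both have the same finite expectation, then `f = g` almost surely. -/
theorem eq_on_support_of_expect_le {p : PMF α} {f g : α → ℝ≥0∞} (h : ∀ a ∈ p.support, f a ≤ g a)
    (hg : expect p g ≤ expect p f) (hfin : expect p f ≠ ∞) : ∀ a ∈ p.support, f a = g a := by
  have h1 : expect p g = expect p f + expect p fun a => g a - f a := by
    rw [← expect_add]
    exact expect_congr_of_support fun a ha => (add_tsub_cancel_of_le (h a ha)).symm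
  have h2 : (expect p fun a => g a - f a) = 0 := by
    have h3 : expect p f + (expect p fun a => g a - f a) ≤ expect p f + 0 := by
      rw [← h1, add_zero]; exact hg
    exact le_antisymm ((ENNReal.add_le_add_iff_left hfin).1 h3) bot_le
  intro a ha
  exact le_antisymm (h a ha) (tsub_eq_zero_iff_le.1 (expect_eq_zero_iff.1 h2 a ha))

theorem expect_comm (p : PMF α) (p' : PMF β) (f : α → β → ℝ≥0∞) :
    (expect p fun a => expect p' fun b => f a b) = expect p' fun b => expect p fun a => f a b := by
  simp only [expect, ← ENNReal.tsum_mul_left]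
  rw [ENNReal.tsum_comm]
  simp only [mul_left_comm]

theorem lintegral_toMeasure [MeasurableSpace α] [MeasurableSingletonClass α] [Countable α]
    (p : PMF α) (f : α → ℝ≥0∞) : ∫⁻ a, f a ∂p.toMeasure = expect p f := by
  rw [lintegral_countable', expect]
  exact tsum_congr fun a => by
    rw [PMF.toMeasure_apply_singleton _ _ (measurableSet_singleton a), mul_comm]

theorem limsup_expect_le [Countable α] (p : PMF α) (f : ℕ → α → ℝ≥0∞) (h : ∀ n a, f n a ≤ 1) :
    limsup (fun n => expect p (f n)) atTop ≤ expect p fun a => limsup (fun n => f n a) atTop := by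
  let _ : MeasurableSpace α := ⊤
  simp only [← lintegral_toMeasure]
  refine limsup_lintegral_le (fun _ => 1) (fun n => measurable_from_top)
    (fun n => ae_of_all _ (h n)) ?_
  simp

theorem tendsto_expect [Countable α] (p : PMF α) {f : ℕ → α → ℝ≥0∞} {g : α → ℝ≥0∞}
    (h : ∀ n a, f n a ≤ 1) (hf : ∀ a, Tendsto (fun n => f n a) atTop (𝓝 (g a))) :
    Tendsto (fun n => expect p (f n)) atTop (𝓝 (expect p g)) := by
  let _ : MeasurableSpace α := ⊤
  simp only [← lintegral_toMeasure]
  refine tendsto_lintegral_of_dominated_convergence (fun _ => 1) (fun n => measurable_from_top)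
    (fun n => ae_of_all _ (h n)) ?_ (ae_of_all _ hf)
  simp

end Expect

/-! ### Independent and binomial laws -/

section Laws

variable {ι : Type*} [Fintype ι]

theorem mem_support_indepLaw {P : ι → PMF ℕ} {x : ι → ℕ} :
    x ∈ (indepLaw P).support ↔ ∀ i, x i ∈ (P i).support := by
  simp [PMF.mem_support_iff, indepLaw_apply, Finset.prod_ne_zero_iff]

theorem expect_indepLaw (P : ι → PMF ℕ) (i : ι) (g : ℕ → ℝ≥0∞) :
    (expect (indepLaw P) fun x => g (x i)) = expect (P i) g := by
  classical
  rw [← lintegral_toMeasure, ← lintegral_toMeasure, indepLaw, Measure.toPMF_toMeasure]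
  exact (measurePreserving_eval (fun i => (P i).toMeasure) i).lintegral_comp
    (measurable_of_countable g)

theorem binomialLaw_apply (n : ℕ) (p : unitInterval) (k : ℕ) :
    binomialLaw n p k = ENNReal.ofReal (n.choose k * (p : ℝ) ^ k * (1 - p) ^ (n - k)) := by
  rw [binomialLaw, Measure.toPMF_apply, binomial_singleton]

theorem le_of_mem_support_binomialLaw {n : ℕ} {p : unitInterval} {k : ℕ}
    (h : k ∈ (binomialLaw n p).support) : k ≤ n := by
  by_contra hk
  exact h (by rw [binomialLaw_apply, Nat.choose_eq_zero_of_lt (not_le.1 hk)]; simp)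

theorem self_mem_support_binomialLaw (n : ℕ) {p : unitInterval} (hp : 0 < (p : ℝ)) :
    n ∈ (binomialLaw n p).support := by
  rw [PMF.mem_support_iff, binomialLaw_apply]
  simp [pow_pos hp]

theorem zero_mem_support_binomialLaw (n : ℕ) {p : unitInterval} (hp : (p : ℝ) < 1) :
    0 ∈ (binomialLaw n p).support := by
  rw [PMF.mem_support_iff, binomialLaw_apply]
  simp [pow_pos (sub_pos.2 hp)]

theorem expect_binomialLaw (n : ℕ) (p : unitInterval) :
    (expect (binomialLaw n p) fun k => (k : ℝ≥0∞)) = ENNReal.ofReal (p * n) := by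
  rw [expect, tsum_eq_sum (s := Finset.range (n + 1))]
  · have h := congrArg (Polynomial.eval (p : ℝ)) (bernsteinPolynomial.sum_smul ℝ n)
    rw [Polynomial.eval_finsetSum] at h
    have h0 : (p : ℝ) * n = ∑ k ∈ Finset.range (n + 1),
        (n.choose k * (p : ℝ) ^ k * (1 - p) ^ (n - k)) * k := by
      simp [bernsteinPolynomial] at h
      rw [mul_comm, ← h]
      exact Finset.sum_congr rfl fun _ _ => mul_comm _ _
    rw [h0, ENNReal.ofReal_sum_of_nonneg]
    · refine Finset.sum_congr rfl fun k _ => ?_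
      rw [binomialLaw_apply, ENNReal.ofReal_mul binomial_nonneg, ENNReal.ofReal_natCast]
    · exact fun k _ => mul_nonneg binomial_nonneg (Nat.cast_nonneg k)
  · intro k hk
    have h1 : binomialLaw n p k = 0 := by
      by_contra h
      exact hk (Finset.mem_range.2 (Nat.lt_succ_of_le (le_of_mem_support_binomialLaw h)))
    rw [h1, zero_mul]

end Laws

/-! ### Ergodicity of Markov chains with a Foster–Lyapunov function -/

section Chain

variable {S : Type*}

theorem lawAt_eq_bind (P : S → PMF S) (ν : PMF S) (n : ℕ) :
    lawAt P ν n = ν.bind fun x => lawAt P (PMF.pure x) n := by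
  induction n with
  | zero => simp [lawAt]
  | succ n ih => simp only [lawAt, ih, PMF.bind_bind]

theorem lawAt_pure_succ (P : S → PMF S) (x : S) (n : ℕ) :
    lawAt P (PMF.pure x) (n + 1) = (P x).bind fun u => lawAt P (PMF.pure u) n := by
  induction n with
  | zero => simp [lawAt]
  | succ n ih => rw [lawAt, ih, PMF.bind_bind]; rfl

theorem lawAt_of_stationary {P : S → PMF S} {π : PMF S} (h : π.bind P = π) (n : ℕ) :
    lawAt P π n = π := by
  induction n with
  | zero => rfl
  | succ n ih => rw [lawAt, ih, h]

/-- The excess of the expectation of `h` at time `n` for the chain started in `x` over that for the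
chain started in `x'`. -/
def gap (P : S → PMF S) (h : S → ℝ≥0∞) (n : ℕ) (x x' : S) : ℝ≥0∞ :=
  expect (lawAt P (PMF.pure x) n) h - expect (lawAt P (PMF.pure x') n) h

theorem gap_le_one {P : S → PMF S} {h : S → ℝ≥0∞} (hh : ∀ x, h x ≤ 1) (n : ℕ) (x x' : S) :
    gap P h n x x' ≤ 1 :=
  tsub_le_self.trans (expect_le_of_le fun a _ => hh a)

/-- Conditioning both chains on their first step, this is Jensen's inequality for the positive part,
which truncated subtraction computes. -/
theorem gap_succ_le (P : S → PMF S) (h : S → ℝ≥0∞) (n : ℕ) (x x' : S) :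
    gap P h (n + 1) x x' ≤ expect (P x) fun u => expect (P x') fun u' => gap P h n u u' := by
  rw [gap, tsub_le_iff_right, lawAt_pure_succ, lawAt_pure_succ, expect_bind, expect_bind,
    ← expect_const (P x) (expect (P x') _), ← expect_add]
  refine expect_mono fun u => ?_
  rw [← expect_add, ← expect_const (P x') (expect (lawAt P (PMF.pure u) n) h)]
  exact expect_mono fun u' => le_tsub_add

/-- A function of two arguments that is subharmonic for two independent copies of the chain. -/
def Subharmonic₂ (P : S → PMF S) (D : S → S → ℝ≥0∞) : Prop :=
  ∀ x x', D x x' ≤ expect (P x) fun u => expect (P x') fun u' => D u u'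

theorem Subharmonic₂.le_lawAt {P : S → PMF S} {D : S → S → ℝ≥0∞} (hD : Subharmonic₂ P D) (n : ℕ) :
    ∀ x x', D x x' ≤ expect (lawAt P (PMF.pure x) n) fun u =>
      expect (lawAt P (PMF.pure x') n) fun u' => D u u' := by
  induction n with
  | zero => intro x x'; simp [lawAt, expect_pure]
  | succ n ih =>
    intro x x'
    rw [lawAt_pure_succ, lawAt_pure_succ, expect_bind]
    refine (hD x x').trans (expect_mono fun u => ?_)
    simp only [expect_bind]
    rw [expect_comm]
    exact expect_mono fun u' => ih u u'

/-- Reverse Fatou, once for each copy of the chain, turns the one-step inequality for the gaps into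
one for their limsup; the bound by 1 supplies the domination. -/
theorem subharmonic₂_limsup_gap [Countable S] {P : S → PMF S} {h : S → ℝ≥0∞}
    (hh : ∀ x, h x ≤ 1) :
    Subharmonic₂ P fun x x' => limsup (fun n => gap P h n x x') atTop := by
  intro x x'
  have h1 : limsup (fun n => gap P h n x x') atTop
      = limsup (fun n => gap P h (n + 1) x x') atTop :=
    (limsup_nat_add (fun n => gap P h n x x') 1).symm
  refine h1.trans_le ?_
  calc _ ≤ limsup (fun n => expect (P x) fun u => expect (P x') fun u' => gap P h n u u') atTop :=
        limsup_le_limsup (Eventually.of_forall fun n => gap_succ_le P h n x x')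
    _ ≤ expect (P x) fun u => limsup (fun n => expect (P x') fun u' => gap P h n u u') atTop :=
        limsup_expect_le _ _ fun n u => expect_le_of_le fun u' _ => gap_le_one hh n u u'
    _ ≤ _ := expect_mono fun u => limsup_expect_le _ _ fun n u' => gap_le_one hh n u u'

/-- A Foster–Lyapunov drift condition: `V` decreases on average by `f - B`, and `f` has finite
sublevel sets. -/
structure Drift (P : S → PMF S) (V f : S → ℝ≥0∞) (B : ℝ≥0∞) : Prop where
  ne_top : ∀ x, V x ≠ ∞
  bound_ne_top : B ≠ ∞
  drift : ∀ x, expect (P x) V + f x ≤ V x + B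
  finite : ∀ R : ℝ≥0∞, R ≠ ∞ → {x | f x ≤ R}.Finite

variable {P : S → PMF S} {V f : S → ℝ≥0∞} {B : ℝ≥0∞}

/-- The threshold `2 * B + 1` is chosen so that a single coordinate beyond it pays for the constant
`B` of both copies and still leaves a decrease of 1. -/
theorem Drift.expect_pair (hd : Drift P V f B) {x x' : S}
    (hx : ¬(f x ≤ 2 * B + 1 ∧ f x' ≤ 2 * B + 1)) :
    (expect (P x) fun u => expect (P x') fun u' => V u + V u') + 1 ≤ V x + V x' := by
  have h1 : (expect (P x) fun u => expect (P x') fun u' => V u + V u')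
      = expect (P x) V + expect (P x') V := by
    simp only [expect_add, expect_const]
  have h2 : 2 * B + 1 ≤ f x + f x' := by
    by_contra! hlt
    exact hx ⟨(le_self_add).trans hlt.le, (le_add_self).trans hlt.le⟩
  have h3 : (expect (P x) V + expect (P x') V + 1) + 2 * B ≤ V x + V x' + 2 * B := by
    calc _ = expect (P x) V + expect (P x') V + (2 * B + 1) := by ring
      _ ≤ expect (P x) V + expect (P x') V + (f x + f x') := by gcongr
      _ = (expect (P x) V + f x) + (expect (P x') V + f x') := by ring
      _ ≤ (V x + B) + (V x' + B) := add_le_add (hd.drift x) (hd.drift x')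
      _ = _ := by ring
  rw [h1]
  exact (ENNReal.add_le_add_iff_right (ENNReal.mul_ne_top (by simp) hd.bound_ne_top)).1 h3

/-- Maximum principle: a bounded subharmonic function is bounded by its values on the set towards
which the chain drifts. -/
theorem Drift.le_of_subharmonic (hd : Drift P V f B) {D : S → S → ℝ≥0∞} (hD : Subharmonic₂ P D)
    (hD1 : ∀ x x', D x x' ≤ 1) {m : ℝ≥0∞}
    (hm : ∀ x x', f x ≤ 2 * B + 1 → f x' ≤ 2 * B + 1 → D x x' ≤ m) (x x' : S) : D x x' ≤ m := by
  -- The penalty `δ (V + V')` makes the argument work although the supremum of `D` need not be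
  -- attained; `δ` is sent to 0 at the end.
  have key : ∀ δ : ℝ≥0∞, δ ≠ 0 → δ ≠ ∞ → ∀ x x', D x x' ≤ m + δ * (V x + V x') := by
    intro δ hδ hδt
    set c : ℝ≥0∞ := ⨆ x, ⨆ x', (D x x' - (m + δ * (V x + V x'))) with hc
    have hle : ∀ u u', D u u' ≤ m + δ * (V u + V u') + c := fun u u' =>
      tsub_le_iff_left.1 (le_iSup₂ (f := fun x x' => D x x' - (m + δ * (V x + V x'))) u u')
    have hc1 : c ≤ 1 := iSup₂_le fun u u' => tsub_le_self.trans (hD1 u u')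
    -- Inside the set the excess is zero. Outside, one step lowers the penalty by at least `δ`, so
    -- the largest excess `c` is at most `c - δ`; being finite, it vanishes.
    have hstep : c ≤ c - δ := by
      refine iSup₂_le fun u u' => ?_
      by_cases hu : f u ≤ 2 * B + 1 ∧ f u' ≤ 2 * B + 1
      · rw [tsub_eq_zero_of_le ((hm u u' hu.1 hu.2).trans le_self_add)]
        exact bot_le
      · rw [tsub_le_iff_left]
        refine le_trans ?_ add_tsub_le_assoc
        refine ENNReal.le_sub_of_add_le_right hδt ?_
        calc D u u' + δ
            ≤ (expect (P u) fun v => expect (P u') fun v' => m + δ * (V v + V v') + c) + δ := by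
              gcongr
              exact (hD u u').trans (expect_mono fun v => expect_mono fun v' => hle v v')
          _ = m + δ * ((expect (P u) fun v => expect (P u') fun v' => V v + V v') + 1) + c := by
              simp only [expect_add, expect_const, expect_const_mul]
              ring
          _ ≤ m + δ * (V u + V u') + c := by
              exact add_le_add (add_le_add le_rfl (mul_le_mul' le_rfl (hd.expect_pair hu))) le_rfl
    have hc0 : c = 0 := by
      by_contra h0
      exact absurd hstep (not_le.2 (ENNReal.sub_lt_self (ne_top_of_le_ne_top (by simp) hc1) h0 hδ))
    intro u u'
    simpa [hc0] using hle u u'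
  refine ENNReal.le_of_forall_pos_le_add fun ε hε _ => ?_
  have hU : V x + V x' + 1 ≠ ∞ := by simp [hd.ne_top]
  have hU0 : V x + V x' + 1 ≠ 0 := by simp
  refine (key (ε / (V x + V x' + 1)) ?_ ?_ x x').trans ?_
  · exact (ENNReal.div_pos (by simpa using hε.ne') hU).ne'
  · exact ENNReal.div_ne_top (by simp) hU0
  · gcongr
    calc ε / (V x + V x' + 1) * (V x + V x') ≤ ε / (V x + V x' + 1) * (V x + V x' + 1) := by
          exact mul_le_mul' le_rfl le_self_add
      _ = ε := ENNReal.div_mul_cancel hU0 hU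

/-- By the maximum principle `D` attains its maximum at a pair in a finite set. Subharmonicity at a
maximum forces `D` to be maximal at every pair reachable from it, in particular at `(y, y)`, where
it is zero. -/
theorem Drift.eq_zero_of_subharmonic (hd : Drift P V f B) (hP : IrreducibleAperiodic P)
    {D : S → S → ℝ≥0∞} (hD : Subharmonic₂ P D) (hD1 : ∀ x x', D x x' ≤ 1) (hD0 : ∀ x, D x x = 0)
    (x x' : S) : D x x' = 0 := by
  obtain ⟨y, hy⟩ := hP
  set F : Set S := {x | f x ≤ 2 * B + 1} with hF
  have hfin : F.Finite :=
    hd.finite _ (by simp [ENNReal.mul_eq_top, hd.bound_ne_top])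
  rcases F.eq_empty_or_nonempty with h0 | hne
  · refine le_antisymm (hd.le_of_subharmonic hD hD1 (fun u u' hu _ => ?_) x x') bot_le
    exact absurd (show u ∈ F from hu) (by simp [h0])
  obtain ⟨z, hz, hmax⟩ := Set.exists_max_image (F ×ˢ F) (fun z => D z.1 z.2)
    (hfin.prod hfin) (hne.prod hne)
  have hle : ∀ u u', D u u' ≤ D z.1 z.2 :=
    hd.le_of_subharmonic hD hD1 fun u u' hu hu' => hmax (u, u') ⟨hu, hu'⟩
  -- Aperiodicity enters here: both copies must be able to be in `y` at the same time.
  obtain ⟨n, hn1, hn2⟩ := ((hy z.1).and (hy z.2)).exists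
  set p := lawAt P (PMF.pure z.1) n
  set p' := lawAt P (PMF.pure z.2) n
  have hfinite : D z.1 z.2 ≠ ∞ := ne_top_of_le_ne_top (by simp) (hD1 _ _)
  have h1 : (expect p fun u => expect p' fun u' => D u u') = D z.1 z.2 :=
    le_antisymm (expect_le_of_le fun u _ => expect_le_of_le fun u' _ => hle u u')
      (hD.le_lawAt n _ _)
  have h2 := eq_on_support_of_expect_le (p := p) (f := fun u => expect p' fun u' => D u u')
    (g := fun _ => D z.1 z.2) (fun u _ => expect_le_of_le fun u' _ => hle u u')
    (by rw [expect_const, h1]) (by rw [h1]; exact hfinite) y hn1.ne'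
  have h3 := eq_on_support_of_expect_le (p := p') (f := fun u' => D y u')
    (g := fun _ => D z.1 z.2) (fun u' _ => hle y u')
    (by rw [expect_const]; exact h2.ge) (h2.trans_ne hfinite) y hn2.ne'
  refine le_antisymm ((hle x x').trans ?_) bot_le
  rw [← h3]
  exact (hD0 y).le

/-- The expectations of a bounded function for the chains started in two points merge. -/
theorem Drift.tendsto_gap [Countable S] (hd : Drift P V f B) (hP : IrreducibleAperiodic P)
    {h : S → ℝ≥0∞} (hh : ∀ x, h x ≤ 1) (x x' : S) :
    Tendsto (fun n => gap P h n x x') atTop (𝓝 0) := by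
  refine tendsto_of_le_liminf_of_limsup_le bot_le ?_
  refine (hd.eq_zero_of_subharmonic hP (subharmonic₂_limsup_gap hh) (fun u u' => ?_)
    (fun u => ?_) x x').le
  · exact limsup_le_of_le (h := Eventually.of_forall fun n => gap_le_one hh n u u')
  · simp [gap]

/-- The expectation from the stationary start does not depend on time, so its distance to the
expectation from `x` is controlled by the gaps averaged over the stationary law, and these vanish by
dominated convergence. -/
theorem Drift.tendsto_of_stationary [Countable S] (hd : Drift P V f B)
    (hP : IrreducibleAperiodic P) {π : PMF S} (hπ : π.bind P = π) {h : S → ℝ≥0∞}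
    (hh : ∀ x, h x ≤ 1) (ν : PMF S) :
    Tendsto (fun n => expect (lawAt P ν n) h) atTop (𝓝 (expect π h)) := by
  have hstat : ∀ n, expect π h = expect π fun x' => expect (lawAt P (PMF.pure x') n) h := by
    intro n
    conv_lhs => rw [← lawAt_of_stationary hπ n, lawAt_eq_bind, expect_bind]
  have hpt : ∀ x, Tendsto (fun n => expect (lawAt P (PMF.pure x) n) h) atTop
      (𝓝 (expect π h)) := by
    intro x
    have hup : Tendsto (fun n => expect π fun x' => gap P h n x x') atTop (𝓝 0) := by
      simpa only [expect_const] using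
        tendsto_expect π (fun n x' => gap_le_one hh n x x') fun x' => hd.tendsto_gap hP hh x x'
    have hlow : Tendsto (fun n => expect π fun x' => gap P h n x' x) atTop (𝓝 0) := by
      simpa only [expect_const] using
        tendsto_expect π (fun n x' => gap_le_one hh n x' x) fun x' => hd.tendsto_gap hP hh x' x
    refine tendsto_of_tendsto_of_tendsto_of_le_of_le
      (g := fun n => expect π h - expect π fun x' => gap P h n x' x)
      (h := fun n => expect π h + expect π fun x' => gap P h n x x') ?_ ?_ ?_ ?_
    · have := ENNReal.Tendsto.sub (tendsto_const_nhds (x := expect π h)) hlow (Or.inr (by simp))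
      simpa using this
    · simpa using (tendsto_const_nhds (x := expect π h)).add hup
    · intro n
      refine tsub_le_iff_right.2 ?_
      show _ ≤ expect (lawAt P (PMF.pure x) n) h + _
      rw [hstat n, ← expect_const π (expect (lawAt P (PMF.pure x) n) h), ← expect_add]
      exact expect_mono fun x' => le_add_tsub
    · intro n
      show expect _ h ≤ expect π h + _
      rw [hstat n, ← expect_const π (expect (lawAt P (PMF.pure x) n) h), ← expect_add]
      exact expect_mono fun x' => le_add_tsub
  have := tendsto_expect ν (fun n x => expect_le_of_le (p := lawAt P (PMF.pure x) n)
    fun a _ => hh a) hpt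
  rw [expect_const] at this
  refine this.congr fun n => ?_
  rw [lawAt_eq_bind P ν, expect_bind]

/-! ### Existence of a stationary law -/

/-- The average over the times `0, …, n` of the expectation of `g`. -/
def cesaro (P : S → PMF S) (x : S) (g : S → ℝ≥0∞) (n : ℕ) : ℝ≥0∞ :=
  (∑ k ∈ Finset.range (n + 1), expect (lawAt P (PMF.pure x) k) g) / (n + 1 : ℕ)

/-- A generalized limit of the averages of the expectation of `g`. -/
def cesaroLim (P : S → PMF S) (x : S) (g : S → ℝ≥0∞) : ℝ≥0∞ :=
  ((hyperfilter ℕ).map (cesaro P x g)).lim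

/-- The extended half-line is compact, so every sequence converges along an ultrafilter and `lim` is
a genuine limit. -/
theorem tendsto_cesaro (P : S → PMF S) (x : S) (g : S → ℝ≥0∞) :
    Tendsto (cesaro P x g) (hyperfilter ℕ) (𝓝 (cesaroLim P x g)) :=
  ((hyperfilter ℕ).map (cesaro P x g)).le_nhds_lim

theorem cesaroLim_add (P : S → PMF S) (x : S) (g g' : S → ℝ≥0∞) :
    cesaroLim P x (fun s => g s + g' s) = cesaroLim P x g + cesaroLim P x g' := by
  refine tendsto_nhds_unique (tendsto_cesaro P x _) ?_
  refine ((tendsto_cesaro P x g).add (tendsto_cesaro P x g')).congr fun n => ?_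
  simp only [cesaro, expect_add, Finset.sum_add_distrib, ENNReal.add_div]

theorem cesaroLim_mul (P : S → PMF S) (x : S) {c : ℝ≥0∞} (hc : c ≠ ∞) (g : S → ℝ≥0∞) :
    cesaroLim P x (fun s => c * g s) = c * cesaroLim P x g := by
  refine tendsto_nhds_unique (tendsto_cesaro P x _) ?_
  refine (ENNReal.Tendsto.const_mul (tendsto_cesaro P x g) (Or.inr hc)).congr fun n => ?_
  simp only [cesaro, expect_const_mul, ← Finset.mul_sum, mul_div_assoc]

theorem cesaroLim_mono (P : S → PMF S) (x : S) {g g' : S → ℝ≥0∞} (h : ∀ s, g s ≤ g' s) :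
    cesaroLim P x g ≤ cesaroLim P x g' := by
  refine le_of_tendsto_of_tendsto' (tendsto_cesaro P x g) (tendsto_cesaro P x g') fun n => ?_
  unfold cesaro
  gcongr
  exact expect_mono h

theorem cesaroLim_sum (P : S → PMF S) (x : S) (F : Finset S) (g : S → S → ℝ≥0∞) :
    cesaroLim P x (fun s => ∑ u ∈ F, g u s) = ∑ u ∈ F, cesaroLim P x (g u) := by
  classical
  induction F using Finset.induction_on with
  | empty => simpa using cesaroLim_mul P x (c := 0) (by simp) fun _ => 0
  | insert i s hi ih => simp only [Finset.sum_insert hi, cesaroLim_add, ih]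

theorem cesaroLim_one (P : S → PMF S) (x : S) : cesaroLim P x (fun _ => 1) = 1 := by
  refine tendsto_nhds_unique (tendsto_cesaro P x _) (tendsto_const_nhds.congr fun n => ?_)
  simp only [cesaro, expect_const, Finset.sum_const, Finset.card_range, nsmul_eq_mul, mul_one]
  rw [ENNReal.div_self (by simp) (by simp)]

/-- A time shift changes the sum of the first `n + 1` terms by boundary terms only; the added one is
at most 1 and disappears after division by `n + 1`. -/
theorem cesaroLim_step_le (P : S → PMF S) (x : S) {g : S → ℝ≥0∞} (hg : ∀ s, g s ≤ 1) :
    cesaroLim P x (fun s => expect (P s) g) ≤ cesaroLim P x g := by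
  have h0 : Tendsto (fun n : ℕ => (1 : ℝ≥0∞) / (n + 1 : ℕ)) atTop (𝓝 0) := by
    have := (tendsto_add_atTop_iff_nat 1).2 ENNReal.tendsto_inv_nat_nhds_zero
    simpa using this
  have h1 := (tendsto_cesaro P x g).add (h0.mono_left Nat.hyperfilter_le_atTop)
  rw [add_zero] at h1
  refine le_of_tendsto_of_tendsto' (tendsto_cesaro P x _) h1 fun n => ?_
  unfold cesaro
  rw [← ENNReal.add_div]
  gcongr
  calc ∑ k ∈ Finset.range (n + 1), expect (lawAt P (PMF.pure x) k) (fun s => expect (P s) g)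
      = ∑ k ∈ Finset.range (n + 1), expect (lawAt P (PMF.pure x) (k + 1)) g := by
        simp only [lawAt, expect_bind]
    _ ≤ ∑ k ∈ Finset.range (n + 1 + 1), expect (lawAt P (PMF.pure x) k) g := by
        rw [Finset.sum_range_succ' _ (n + 1)]; exact le_self_add
    _ ≤ _ := by
        rw [Finset.sum_range_succ _ (n + 1)]
        gcongr
        exact expect_le_of_le fun s _ => hg s

/-- Summing the drift inequality over time telescopes `V`, and the initial value `V x` is negligible
in the average. -/
theorem Drift.cesaroLim_le (hd : Drift P V f B) (x : S) : cesaroLim P x f ≤ B := by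
  have hsum : ∀ n, ∑ k ∈ Finset.range n, expect (lawAt P (PMF.pure x) k) f
      + expect (lawAt P (PMF.pure x) n) V ≤ V x + n * B := by
    intro n
    induction n with
    | zero => simp [lawAt, expect_pure]
    | succ n ih =>
      have h1 : expect (lawAt P (PMF.pure x) (n + 1)) V + expect (lawAt P (PMF.pure x) n) f
          ≤ expect (lawAt P (PMF.pure x) n) V + B := by
        rw [lawAt, expect_bind, ← expect_add, ← expect_const (lawAt P (PMF.pure x) n) B,
          ← expect_add]
        exact expect_mono hd.drift
      rw [Finset.sum_range_succ]
      calc _ = ∑ k ∈ Finset.range n, expect (lawAt P (PMF.pure x) k) f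
            + (expect (lawAt P (PMF.pure x) (n + 1)) V + expect (lawAt P (PMF.pure x) n) f) := by
            ring
        _ ≤ ∑ k ∈ Finset.range n, expect (lawAt P (PMF.pure x) k) f
            + (expect (lawAt P (PMF.pure x) n) V + B) := by gcongr
        _ = ∑ k ∈ Finset.range n, expect (lawAt P (PMF.pure x) k) f
            + expect (lawAt P (PMF.pure x) n) V + B := by ring
        _ ≤ V x + n * B + B := by gcongr
        _ = _ := by push_cast; ring
  have h0 : Tendsto (fun n : ℕ => V x * (1 / (n + 1 : ℕ))) atTop (𝓝 0) := by
    have := (tendsto_add_atTop_iff_nat 1).2 ENNReal.tendsto_inv_nat_nhds_zero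
    simpa using ENNReal.Tendsto.const_mul this (Or.inr (hd.ne_top x))
  have h1 := (h0.mono_left Nat.hyperfilter_le_atTop).add (tendsto_const_nhds (x := B))
  rw [zero_add] at h1
  refine le_of_tendsto_of_tendsto' (tendsto_cesaro P x f) h1 fun n => ?_
  unfold cesaro
  calc _ ≤ (V x + (n + 1 : ℕ) * B) / (n + 1 : ℕ) := by
        gcongr
        exact le_self_add.trans (hsum (n + 1))
    _ = _ := by
        rw [ENNReal.add_div, mul_comm _ B, mul_one_div,
          ENNReal.mul_div_cancel_right (by simp) (by simp)]

/-- The law with the weights `cesaroLim` of the points is stationary. -/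
theorem Drift.exists_stationary (hd : Drift P V f B) (x : S) :
    ∃ π : PMF S, π.bind P = π ∧ expect π f ≤ B := by
  classical
  set w : S → ℝ≥0∞ := fun u => cesaroLim P x fun s => if s = u then 1 else 0 with hw
  have hcoef : ∀ (g : S → ℝ≥0∞), (∀ s, g s ≠ ∞) → ∀ F : Finset S,
      ∑ u ∈ F, w u * g u = cesaroLim P x fun s => if s ∈ F then g s else 0 := by
    intro g hg F
    have h1 : (fun s => if s ∈ F then g s else 0)
        = fun s => ∑ u ∈ F, g u * if s = u then 1 else 0 := by
      funext s
      simp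
    rw [h1, cesaroLim_sum]
    exact Finset.sum_congr rfl fun u _ => by rw [cesaroLim_mul _ _ (hg u), mul_comm]
  -- The generalized limit is only finitely additive; for countable sums one inequality survives, in
  -- the manner of Fatou.
  have hle : ∀ g : S → ℝ≥0∞, (∀ s, g s ≠ ∞) → ∑' u, w u * g u ≤ cesaroLim P x g := by
    intro g hg
    rw [ENNReal.tsum_eq_iSup_sum]
    refine iSup_le fun F => ?_
    rw [hcoef g hg F]
    exact cesaroLim_mono P x fun s => by split_ifs <;> simp
  have hsum_le : ∑' u, w u ≤ 1 := by
    simpa [cesaroLim_one] using hle (fun _ => 1) (by simp)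
  -- No mass escapes to infinity: off the finite set `{f ≤ r⁻¹}` one has `1 ≤ r f`, and the average
  -- of `r f` is at most `r B ≤ ε`.
  have hsum_ge : 1 ≤ ∑' u, w u := by
    refine ENNReal.le_of_forall_pos_le_add fun ε hε _ => ?_
    have hε' : (ε : ℝ≥0∞) ≠ 0 := by simpa using hε.ne'
    have hB1 : B + 1 ≠ ∞ := by simp [hd.bound_ne_top]
    set r : ℝ≥0∞ := ε / (B + 1) with hr
    have hr0 : r ≠ 0 := (ENNReal.div_pos hε' hB1).ne'
    have hrt : r ≠ ∞ := ENNReal.div_ne_top (by simp) (by simp)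
    have hfin := hd.finite r⁻¹ (by simpa using hr0)
    have h1 : (1 : ℝ≥0∞) ≤ (∑ u ∈ hfin.toFinset, w u * 1) + r * B := by
      rw [hcoef (fun _ => 1) (by simp)]
      calc (1 : ℝ≥0∞) = cesaroLim P x fun _ => 1 := (cesaroLim_one P x).symm
        _ ≤ cesaroLim P x fun s => (if s ∈ hfin.toFinset then 1 else 0) + r * f s := by
            refine cesaroLim_mono P x fun s => ?_
            by_cases hs : s ∈ hfin.toFinset
            · rw [if_pos hs]; exact le_self_add
            · simp only [hs, if_false, zero_add]
              have hs' : r⁻¹ < f s := by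
                rw [Set.Finite.mem_toFinset] at hs
                exact not_le.1 hs
              calc (1 : ℝ≥0∞) = r * r⁻¹ := (ENNReal.mul_inv_cancel hr0 hrt).symm
                _ ≤ _ := by gcongr
        _ = (cesaroLim P x fun s => if s ∈ hfin.toFinset then 1 else 0)
            + r * cesaroLim P x f := by rw [cesaroLim_add, cesaroLim_mul _ _ hrt]
        _ ≤ _ := by gcongr; exact hd.cesaroLim_le x
    refine h1.trans (add_le_add ?_ ?_)
    · simpa using ENNReal.sum_le_tsum (f := w) hfin.toFinset
    · calc r * B ≤ ε / (B + 1) * (B + 1) := by rw [hr]; gcongr; exact le_self_add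
        _ = ε := ENNReal.div_mul_cancel (by simp) hB1
  have hsum : ∑' u, w u = 1 := le_antisymm hsum_le hsum_ge
  let π : PMF S := ⟨w, hsum ▸ ENNReal.summable.hasSum⟩
  have hπ : ∀ u, π u = w u := fun _ => rfl
  refine ⟨π, ?_, ?_⟩
  · have hpt : ∀ z, (π.bind P) z ≤ π z := by
      intro z
      rw [PMF.bind_apply]
      refine (hle (fun u => P u z) fun u => PMF.apply_ne_top _ _).trans ?_
      have h1 := cesaroLim_step_le P x (g := fun s => if s = z then 1 else 0)
        fun s => by split_ifs <;> simp
      have h2 : ∀ s, (expect (P s) fun u => if u = z then 1 else 0) = P s z := fun s => by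
        simp [expect]
      simp only [h2] at h1
      exact h1
    -- The inequality between the two laws at every point must be an equality, since both have total
    -- mass 1.
    ext z
    by_contra hne
    have hlt : ∑' z, (π.bind P) z < ∑' z, π z :=
      ENNReal.tsum_lt_tsum (by simp [PMF.tsum_coe]) hpt (lt_of_le_of_ne (hpt z) hne)
    rw [PMF.tsum_coe, PMF.tsum_coe] at hlt
    exact lt_irrefl _ hlt
  · refine (hle f fun s => ?_).trans (hd.cesaroLim_le x)
    refine ne_top_of_le_ne_top (ENNReal.add_ne_top.2 ⟨hd.ne_top s, hd.bound_ne_top⟩)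
      (le_add_self.trans (hd.drift s))

/-- A chain with a Foster–Lyapunov function converges to a stationary law. -/
theorem Drift.ergodic [Countable S] (hd : Drift P V f B) (hP : IrreducibleAperiodic P) :
    ∃ π : PMF S, expect π f ≤ B ∧ ∀ (ν : PMF S) (h : S → ℝ≥0∞), (∀ x, h x ≤ 1) →
      Tendsto (fun n => expect (lawAt P ν n) h) atTop (𝓝 (expect π h)) := by
  obtain ⟨π, hπ, hf⟩ := hd.exists_stationary hP.choose
  exact ⟨π, hf, fun ν h hh => hd.tendsto_of_stationary hP hπ hh ν⟩

/-- A nonnegative function that is subharmonic on the support of a stationary law and integrable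
does not change along the chain. -/
theorem eq_of_stationary_of_subharmonic {π : PMF S} (hπ : π.bind P = π) {h : S → ℝ≥0∞}
    (hfin : expect π h ≠ ∞) (hsub : ∀ x ∈ π.support, h x ≤ expect (P x) h) :
    ∀ x ∈ π.support, ∀ u ∈ (P x).support, h u = h x := by
  have hstat : ∀ g : S → ℝ≥0∞, (expect π fun x => expect (P x) g) = expect π g := by
    intro g
    rw [← expect_bind, hπ]
  have h1 : ∀ x ∈ π.support, h x = expect (P x) h :=
    eq_on_support_of_expect_le hsub (hstat h).le hfin
  intro x hx
  have hx_fin : h x ≠ ∞ := ne_top_of_expect_ne_top hfin hx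
  -- By now `h` is harmonic on the support. Its truncation at the level `h x` is superharmonic, and
  -- stationarity makes it harmonic too. At `x` this forces both `min (h u) (h x) = h u` and `min (h
  -- u) (h x) = h x` for all successors `u`.
  have h2 : ∀ z ∈ π.support, (expect (P z) fun u => min (h u) (h x)) = min (h z) (h x) := by
    refine eq_on_support_of_expect_le (fun z hz => ?_) (hstat _).ge ?_
    · refine le_min ?_ (expect_le_of_le fun u _ => min_le_right _ _)
      rw [h1 z hz]
      exact expect_mono fun u => min_le_left _ _
    · rw [hstat]
      exact ne_top_of_le_ne_top hfin (expect_mono fun u => min_le_left _ _)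
  have h3 := h2 x hx
  rw [min_self] at h3
  have h4 := eq_on_support_of_expect_le (p := P x) (f := fun u => min (h u) (h x)) (g := h)
    (fun u _ => min_le_left _ _) (by rw [h3, ← h1 x hx]) (by rwa [h3])
  have h5 := eq_on_support_of_expect_le (p := P x) (f := fun u => min (h u) (h x))
    (g := fun _ => h x) (fun u _ => min_le_right _ _) (by rw [h3, expect_const]) (by rwa [h3])
  exact fun u hu => (h4 u hu).symm.trans (h5 u hu)

end Chain

/-! ### The switch as a Markov chain, and the max-weight functional -/

section Model

variable {K : ℕ}

/-! ### Stability in terms of expectations -/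

theorem stable_of_tendsto_expect {M : Switch K} {W : Policy K} {A : Pair K → PMF ℕ}
    {π : PMF (PairVec K)} (hπ : ∀ e, (expect π fun x => (x e : ℝ≥0∞)) ≠ ∞)
    (h : ∀ (ν : PMF (PairVec K)) (g : PairVec K → ℝ≥0∞), (∀ x, g x ≤ 1) →
      Tendsto (fun n => expect (lawAt (queueStep M W A) ν n) g) atTop (𝓝 (expect π g))) :
    Stable M W A := by
  refine ⟨⟨π.toMeasure, inferInstance⟩, fun ν => ?_, fun e => ?_⟩
  · refine ProbabilityMeasure.tendsto_iff_forall_lintegral_tendsto.2 fun g => ?_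
    -- Convergence is available for functions bounded by 1, so `g` is rescaled; the summand 1 keeps
    -- the factor nonzero.
    set c : ℝ≥0 := nndist 0 g + 1
    have hc0 : (c : ℝ≥0∞) ≠ 0 := by simp [c]
    have hg : ∀ x, (c : ℝ≥0∞)⁻¹ * g x ≤ 1 := by
      intro x
      rw [mul_comm, ← div_eq_mul_inv]
      refine ENNReal.div_le_of_le_mul ?_
      rw [one_mul]
      norm_cast
      exact (g.apply_le_nndist_zero x).trans le_self_add
    have h1 := ENNReal.Tendsto.const_mul (h ν (fun x => (c : ℝ≥0∞)⁻¹ * g x) hg)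
      (Or.inr (ENNReal.coe_ne_top (r := c)))
    simp only [expect_const_mul, ← mul_assoc, ENNReal.mul_inv_cancel hc0 ENNReal.coe_ne_top,
      one_mul] at h1
    simpa only [queueLaw, ProbabilityMeasure.coe_mk, lintegral_toMeasure] using h1
  · refine ⟨(measurable_of_countable _).aestronglyMeasurable, ?_⟩
    simp only [ProbabilityMeasure.coe_mk, HasFiniteIntegral, lintegral_toMeasure]
    simpa [lt_top_iff_ne_top] using hπ e

/-- The limit law is invariant because the kernel maps functions bounded by 1 to such functions, and
all of them are continuous in the discrete topology; so the limits at times `n` and `n + 1` can be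
compared. -/
theorem exists_stationary_of_stable {M : Switch K} {W : Policy K} {A : Pair K → PMF ℕ}
    (h : Stable M W A) :
    ∃ π : PMF (PairVec K), π.bind (queueStep M W A) = π ∧
      ∀ e, (expect π fun x => (x e : ℝ≥0∞)) ≠ ∞ := by
  obtain ⟨Q, hQ, hint⟩ := h
  have hto : (Q : Measure (PairVec K)).toPMF.toMeasure = Q := Measure.toPMF_toMeasure _
  refine ⟨(Q : Measure (PairVec K)).toPMF, ?_, fun e => ?_⟩
  · have hlim : ∀ g : PairVec K → ℝ≥0∞, (∀ x, g x ≤ 1) →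
        Tendsto (fun n => expect (lawAt (queueStep M W A) (PMF.pure 0) n) g) atTop
          (𝓝 (expect (Q : Measure (PairVec K)).toPMF g)) := by
      intro g hg
      have hgt : ∀ x, g x ≠ ∞ := fun x => ne_top_of_le_ne_top (by simp) (hg x)
      have h1 := ProbabilityMeasure.tendsto_iff_forall_lintegral_tendsto.1 (hQ (PMF.pure 0))
        (BoundedContinuousFunction.mkOfBound ⟨fun x => (g x).toNNReal,
          continuous_of_discreteTopology⟩ 1 fun x y => by
            have hb : ∀ x, ((g x).toNNReal : ℝ) ≤ 1 := fun x => by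
              have := ENNReal.toNNReal_mono (by simp) (hg x)
              exact_mod_cast this
            have h0 : ∀ x, 0 ≤ ((g x).toNNReal : ℝ) := fun x => NNReal.coe_nonneg _
            change dist (g x).toNNReal (g y).toNNReal ≤ 1
            rw [NNReal.dist_eq, abs_le]
            constructor <;> linarith [hb x, hb y, h0 x, h0 y])
      rw [← lintegral_toMeasure, hto]
      simpa [queueLaw, lintegral_toMeasure, ENNReal.coe_toNNReal, hgt] using h1
    have hstep : ∀ g : PairVec K → ℝ≥0∞, (∀ x, g x ≤ 1) →
        expect ((Q : Measure (PairVec K)).toPMF.bind (queueStep M W A)) g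
          = expect (Q : Measure (PairVec K)).toPMF g := by
      intro g hg
      rw [expect_bind]
      refine tendsto_nhds_unique (hlim _ fun x => expect_le_of_le fun u _ => hg u) ?_
      refine ((tendsto_add_atTop_iff_nat 1).2 (hlim g hg)).congr fun n => ?_
      rw [lawAt, expect_bind]
    classical
    ext z
    have := hstep (fun u => if u = z then 1 else 0) fun u => by split_ifs <;> simp
    simpa only [expect, mul_ite, mul_one, mul_zero, tsum_ite_eq] using this
  · have h1 := (hint e).2
    rw [← hto] at h1
    simp only [HasFiniteIntegral, lintegral_toMeasure] at h1
    simpa [lt_top_iff_ne_top] using h1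

/-! ### One step of the queue lengths -/

section Step

variable {M : Switch K} {W : Policy K} {A : Pair K → PMF ℕ}

theorem expect_queueStep (x : PairVec K) (g : PairVec K → ℝ≥0∞) :
    expect (queueStep M W A x) g = expect M.availLaw fun a => expect (W x a) fun w =>
      expect (indepLaw fun e => binomialLaw (min (w e) (x e)) (M.q e)) fun d =>
        expect (indepLaw A) fun n => g fun e => x e - d e + n e := by
  simp only [queueStep, expect_bind, expect_map, Function.comp_def]

theorem mem_support_queueStep {x u : PairVec K} :
    u ∈ (queueStep M W A x).support ↔ ∃ a ∈ M.availLaw.support, ∃ w ∈ (W x a).support,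
      ∃ d : PairVec K, (∀ e, d e ∈ (binomialLaw (min (w e) (x e)) (M.q e)).support) ∧
        ∃ n : PairVec K, (∀ e, n e ∈ (A e).support) ∧ (fun e => x e - d e + n e) = u := by
  simp only [queueStep, PMF.mem_support_bind_iff, PMF.mem_support_map_iff, mem_support_indepLaw]

theorem le_attempts_of_mem_support {a : Fin K → ℕ} (ha : a ∈ M.availLaw.support) (i : Fin K) :
    a i ≤ M.attempts := by
  have h := mem_support_indepLaw.1 ha i
  obtain ⟨k, hk, hk'⟩ := (PMF.mem_support_bind_iff _ _ _).1 h
  exact (M.yield_le _ _ hk').trans (le_of_mem_support_binomialLaw hk)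

theorem mem_availStates_of_mem_support {a : Fin K → ℕ} (ha : a ∈ M.availLaw.support) :
    a ∈ M.availStates :=
  Fintype.mem_piFinset.2 fun i =>
    Finset.mem_range.2 (Nat.lt_succ_of_le (le_attempts_of_mem_support ha i))

theorem le_of_mem_feasible {a : Fin K → ℕ} {w : PairVec K} (hw : w ∈ feasible a) (e : Pair K) :
    w e ≤ a e.1.1 := by
  simp only [feasible, Finset.mem_filter, Fintype.mem_piFinset, Finset.mem_range] at hw
  exact Nat.le_of_lt_succ (hw.1 e)

theorem feasible_mono {a : Fin K → ℕ} {w w' : PairVec K} (hw : w ∈ feasible a)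
    (h : ∀ e, w' e ≤ w e) : w' ∈ feasible a :=
  (mem_feasible _ _).2 fun j =>
    (Finset.sum_le_sum fun e _ => h e).trans ((mem_feasible _ _).1 hw j)

theorem zero_mem_feasible (a : Fin K → ℕ) : (0 : PairVec K) ∈ feasible a :=
  (mem_feasible _ _).2 fun j => by simp

theorem single_mem_feasible {a : Fin K → ℕ} (ha : ∀ i, 1 ≤ a i) (e : Pair K) :
    (Pi.single e 1 : PairVec K) ∈ feasible a := by
  refine (mem_feasible _ _).2 fun j => (ha j).trans' ?_
  calc ∑ e' with Touches e' j, (Pi.single e 1 : PairVec K) e'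
      ≤ ∑ e', (Pi.single e 1 : PairVec K) e' :=
        Finset.sum_le_sum_of_subset (Finset.filter_subset _ _)
    _ = 1 := by simp

/-- With positive probability, entanglements are available on all links. -/
theorem exists_mem_support_availLaw (hT : ∀ i : Fin K, M.purifiedLaw i 0 ≠ 1) :
    ∃ a ∈ M.availLaw.support, ∀ i, 1 ≤ a i := by
  have h : ∀ i, ∃ k ∈ (M.purifiedLaw i).support, 1 ≤ k := by
    intro i
    by_contra! hcon
    refine hT i ((PMF.apply_eq_one_iff _ _).2 (Set.Subset.antisymm (fun k hk => ?_) ?_))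
    · exact Nat.lt_one_iff.1 (hcon k hk)
    · obtain ⟨k, hk⟩ := (M.purifiedLaw i).support_nonempty
      have h0 := Nat.lt_one_iff.1 (hcon k hk)
      exact Set.singleton_subset_iff.2 (h0 ▸ hk)
  choose k hk hk1 using h
  exact ⟨k, mem_support_indepLaw.2 hk, hk1⟩

end Step

/-! ### Maximal weights -/

section Weight

variable (M : Switch K)

/-- The weight of the schedule `π` for the weights `c` of the pairs. -/
def weight (π : PairVec K) (c : Pair K → ℝ) : ℝ := ∑ e, (π e : ℝ) * (M.q e : ℝ) * c e

/-- The maximal weight of a schedule that is feasible for `a`. -/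
def maxWeight (a : Fin K → ℕ) (c : Pair K → ℝ) : ℝ :=
  (feasible a).sup' ⟨0, zero_mem_feasible a⟩ fun π => weight M π c

/-- The mean over the availability of the maximal weight. -/
def meanWeight (c : Pair K → ℝ) : ℝ :=
  ∑ a ∈ M.availStates, (M.availLaw a).toReal * maxWeight M a c

variable {M}

theorem weight_le_maxWeight {a : Fin K → ℕ} {π : PairVec K} (hπ : π ∈ feasible a)
    (c : Pair K → ℝ) : weight M π c ≤ maxWeight M a c :=
  Finset.le_sup' (fun π => weight M π c) hπ

theorem exists_weight_eq_maxWeight (M : Switch K) (a : Fin K → ℕ) (c : Pair K → ℝ) :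
    ∃ π ∈ feasible a, weight M π c = maxWeight M a c := by
  obtain ⟨π, hπ, h⟩ := Finset.exists_mem_eq_sup' ⟨0, zero_mem_feasible a⟩
    fun π => weight M π c
  exact ⟨π, hπ, h.symm⟩

theorem maxWeight_nonneg (M : Switch K) (a : Fin K → ℕ) (c : Pair K → ℝ) :
    0 ≤ maxWeight M a c := by
  refine le_trans ?_ (weight_le_maxWeight (zero_mem_feasible a) c)
  simp [weight]

theorem meanWeight_nonneg (M : Switch K) (c : Pair K → ℝ) : 0 ≤ meanWeight M c :=
  Finset.sum_nonneg fun a _ => mul_nonneg ENNReal.toReal_nonneg (maxWeight_nonneg M a c)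

theorem maxWeight_mono (M : Switch K) (a : Fin K → ℕ) {c c' : Pair K → ℝ} (h : ∀ e, c e ≤ c' e) :
    maxWeight M a c ≤ maxWeight M a c' := by
  refine Finset.sup'_le _ _ fun π hπ => le_trans ?_ (weight_le_maxWeight hπ c')
  refine Finset.sum_le_sum fun e _ => mul_le_mul_of_nonneg_left (h e) ?_
  exact mul_nonneg (Nat.cast_nonneg _) (M.q e).2.1

theorem mul_le_maxWeight {a : Fin K → ℕ} (ha : ∀ i, 1 ≤ a i) (c : Pair K → ℝ) (e : Pair K) :
    M.q e * c e ≤ maxWeight M a c := by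
  refine le_trans (le_of_eq ?_) (weight_le_maxWeight (single_mem_feasible ha e) c)
  rw [weight, Finset.sum_eq_single e] <;> simp +contextual

theorem expect_availLaw_ofReal (g : (Fin K → ℕ) → ℝ) (hg : ∀ a, 0 ≤ g a) :
    (expect M.availLaw fun a => ENNReal.ofReal (g a))
      = ENNReal.ofReal (∑ a ∈ M.availStates, (M.availLaw a).toReal * g a) := by
  rw [expect, tsum_eq_sum (s := M.availStates), ENNReal.ofReal_sum_of_nonneg]
  · refine Finset.sum_congr rfl fun a _ => ?_
    rw [ENNReal.ofReal_mul ENNReal.toReal_nonneg, ENNReal.ofReal_toReal (PMF.apply_ne_top _ _)]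
  · exact fun a _ => mul_nonneg ENNReal.toReal_nonneg (hg a)
  · intro a ha
    have h0 : M.availLaw a = 0 := by
      by_contra h
      exact ha (mem_availStates_of_mem_support h)
    rw [h0, zero_mul]

theorem expect_maxWeight (M : Switch K) (c : Pair K → ℝ) :
    (expect M.availLaw fun a => ENNReal.ofReal (maxWeight M a c))
      = ENNReal.ofReal (meanWeight M c) :=
  expect_availLaw_ofReal _ fun a => maxWeight_nonneg M a c

theorem IsMaxWeight.weight_eq {W : Policy K} (hW : IsMaxWeight M W) {x : PairVec K}
    {a : Fin K → ℕ} {w : PairVec K} (hw : w ∈ (W x a).support) :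
    weight M w (fun e => (x e : ℝ)) = maxWeight M a fun e => (x e : ℝ) :=
  le_antisymm (weight_le_maxWeight (hW x a w hw).1 _)
    (Finset.sup'_le _ _ fun π hπ => (hW x a w hw).2 π hπ)

end Weight

end Model

/-! ### From `Λ^PS` to stability: quadratic drift -/

section Sufficiency

variable {K : ℕ} {M : Switch K} {W : Policy K} {A : Pair K → PMF ℕ} {lam : Pair K → ℝ≥0}

/-! ### Moments of arrivals and departures -/

theorem HasRates.expect_eq (h : HasRates A lam) (e : Pair K) :
    (expect (A e) fun k => (k : ℝ≥0∞)) = lam e := by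
  have h1 := ofReal_integral_eq_lintegral_ofReal (h e).1 (ae_of_all _ fun k => Nat.cast_nonneg k)
  rw [(h e).2, lintegral_toMeasure] at h1
  simpa using h1.symm

theorem FiniteSecondMoments.expect_sq_ne_top (h : FiniteSecondMoments A) (e : Pair K) :
    (expect (A e) fun k => (k : ℝ≥0∞) ^ 2) ≠ ∞ := by
  have h1 := (h e).integrable_sq.2
  simp only [HasFiniteIntegral, lintegral_toMeasure] at h1
  simpa [lt_top_iff_ne_top] using h1

theorem expect_arrivals (h : HasRates A lam) (c : Pair K → ℝ≥0∞) :
    (expect (indepLaw A) fun n => ∑ e, c e * (n e : ℝ≥0∞)) = ∑ e, c e * lam e := by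
  simp only [expect_finset_sum, expect_const_mul]
  exact Finset.sum_congr rfl fun e _ => by
    rw [expect_indepLaw A e fun k => (k : ℝ≥0∞), h.expect_eq]

theorem expect_departures (M : Switch K) (u : PairVec K) (c : Pair K → ℝ≥0∞) :
    (expect (indepLaw fun e => binomialLaw (u e) (M.q e)) fun d => ∑ e, c e * (d e : ℝ≥0∞))
      = ∑ e, c e * ENNReal.ofReal (M.q e * u e) := by
  simp only [expect_finset_sum, expect_const_mul]
  exact Finset.sum_congr rfl fun e _ => by
    rw [expect_indepLaw (fun e => binomialLaw (u e) (M.q e)) e fun k => (k : ℝ≥0∞),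
      expect_binomialLaw]

/-- The mean of `∑ c d` for the departures `d` in a slot with queue lengths `x`. -/
def meanService (M : Switch K) (W : Policy K) (x : PairVec K) (c : Pair K → ℝ≥0∞) : ℝ≥0∞ :=
  expect M.availLaw fun a => expect (W x a) fun w =>
    ∑ e, c e * ENNReal.ofReal (M.q e * (min (w e) (x e) : ℕ))

theorem departure_le {x w d : PairVec K}
    (hd : d ∈ (indepLaw fun e => binomialLaw (min (w e) (x e)) (M.q e)).support) (e : Pair K) :
    d e ≤ min (w e) (x e) :=
  le_of_mem_support_binomialLaw (mem_support_indepLaw.1 hd e)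

/-- Conservation of requests, with departures kept on the left to avoid subtraction of extended
reals; it is exact because `d ≤ x`. -/
theorem expect_queueStep_linear (h : HasRates A lam) (x : PairVec K) (c : Pair K → ℝ≥0∞) :
    (expect (queueStep M W A x) fun u => ∑ e, c e * (u e : ℝ≥0∞)) + meanService M W x c
      = ∑ e, c e * (x e : ℝ≥0∞) + ∑ e, c e * lam e := by
  rw [expect_queueStep, meanService, ← expect_add,
    ← expect_const M.availLaw (∑ e, c e * (x e : ℝ≥0∞) + ∑ e, c e * lam e)]
  congr 1
  funext a
  rw [← expect_add, ← expect_const (W x a) (∑ e, c e * (x e : ℝ≥0∞) + ∑ e, c e * lam e)]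
  congr 1
  funext w
  rw [← expect_departures M (fun e => min (w e) (x e)), ← expect_add]
  rw [← expect_const (indepLaw fun e => binomialLaw (min (w e) (x e)) (M.q e))
    (∑ e, c e * (x e : ℝ≥0∞) + ∑ e, c e * lam e)]
  refine expect_congr_of_support fun d hd => ?_
  rw [← expect_const (indepLaw A) (∑ e, c e * (d e : ℝ≥0∞)), ← expect_add,
    ← expect_arrivals h, ← expect_const (indepLaw A) (∑ e, c e * (x e : ℝ≥0∞)), ← expect_add]
  congr 1
  funext n
  simp only [← Finset.sum_add_distrib, ← mul_add]
  refine Finset.sum_congr rfl fun e _ => ?_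
  have h1 := (departure_le hd e).trans (min_le_right _ _)
  congr 1
  norm_cast
  omega

/-- The attempted swaps `min (w e) (x e)` form a feasible schedule themselves, so no choice of
weights `c` can yield more than the maximum. -/
theorem meanService_le (hW : IsMaxWeight M W) (x : PairVec K) (c : Pair K → ℝ≥0) :
    (meanService M W x fun e => c e) ≤ ENNReal.ofReal (meanWeight M fun e => c e) := by
  rw [← expect_maxWeight]
  refine expect_mono fun a => expect_le_of_le fun w hw => ?_
  have h1 : ∑ e, (c e : ℝ≥0∞) * ENNReal.ofReal (M.q e * (min (w e) (x e) : ℕ))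
      = ENNReal.ofReal (weight M (fun e => min (w e) (x e)) fun e => c e) := by
    rw [weight, ENNReal.ofReal_sum_of_nonneg]
    · refine Finset.sum_congr rfl fun e _ => ?_
      rw [← ENNReal.ofReal_coe_nnreal, ← ENNReal.ofReal_mul (NNReal.coe_nonneg _)]
      congr 1
      ring
    · exact fun e _ => mul_nonneg (mul_nonneg (Nat.cast_nonneg _) (M.q e).2.1)
        (NNReal.coe_nonneg _)
  rw [h1]
  exact ENNReal.ofReal_le_ofReal (weight_le_maxWeight
    (feasible_mono (hW x a w hw).1 fun e => min_le_left _ _) _)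

/-- Truncating a schedule at the queue length costs weight only where `x e < w e ≤ M.attempts`,
hence at most `M.attempts ^ 2` per pair. -/
theorem ofReal_meanWeight_le_meanService (hW : IsMaxWeight M W) (x : PairVec K) :
    ENNReal.ofReal (meanWeight M fun e => (x e : ℝ))
      ≤ meanService M W x (fun e => (x e : ℝ≥0∞)) + ∑ _e : Pair K, (M.attempts : ℝ≥0∞) ^ 2 := by
  rw [← expect_maxWeight, meanService,
    ← expect_const M.availLaw (∑ _e : Pair K, (M.attempts : ℝ≥0∞) ^ 2), ← expect_add]
  refine expect_mono_of_support fun a ha => ?_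
  rw [← expect_const (W x a) (ENNReal.ofReal _),
    ← expect_const (W x a) (∑ _e : Pair K, (M.attempts : ℝ≥0∞) ^ 2), ← expect_add]
  refine expect_mono_of_support fun w hw => ?_
  rw [← hW.weight_eq hw, weight, ENNReal.ofReal_sum_of_nonneg, ← Finset.sum_add_distrib]
  · refine Finset.sum_le_sum fun e _ => ?_
    have hwL : w e ≤ M.attempts :=
      (le_of_mem_feasible (hW x a w hw).1 e).trans (le_attempts_of_mem_support ha _)
    have h1 : w e * x e ≤ x e * min (w e) (x e) + M.attempts ^ 2 := by
      rcases le_total (w e) (x e) with h | h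
      · rw [min_eq_left h]; nlinarith
      · have := Nat.mul_le_mul hwL (h.trans hwL)
        rw [sq]
        omega
    have h2 : (w e : ℝ) * x e ≤ x e * (min (w e) (x e) : ℕ) + (M.attempts : ℝ) ^ 2 := by
      exact_mod_cast h1
    have hq0 : (0 : ℝ) ≤ M.q e := (M.q e).2.1
    have hq1 : (M.q e : ℝ) ≤ 1 := (M.q e).2.2
    calc ENNReal.ofReal (w e * M.q e * x e)
        ≤ ENNReal.ofReal (x e * (M.q e * (min (w e) (x e) : ℕ)) + (M.attempts : ℝ) ^ 2) := by
          refine ENNReal.ofReal_le_ofReal ?_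
          nlinarith [mul_le_mul_of_nonneg_left h2 hq0, sq_nonneg (M.attempts : ℝ)]
      _ = _ := by
          rw [ENNReal.ofReal_add (by positivity) (by positivity),
            ENNReal.ofReal_mul (Nat.cast_nonneg _), ENNReal.ofReal_natCast,
            ENNReal.ofReal_pow (Nat.cast_nonneg _), ENNReal.ofReal_natCast]
  · exact fun e _ => mul_nonneg (mul_nonneg (Nat.cast_nonneg _) (M.q e).2.1) (Nat.cast_nonneg _)

theorem expect_queueStep_sq_le (hW : IsMaxWeight M W) (h : HasRates A lam) (x : PairVec K) :
    (expect (queueStep M W A x) fun u => ∑ e, (u e : ℝ≥0∞) ^ 2)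
        + 2 * meanService M W x (fun e => (x e : ℝ≥0∞))
      ≤ ∑ e, (x e : ℝ≥0∞) ^ 2 + 2 * ∑ e, (x e : ℝ≥0∞) * lam e
        + ∑ e, ((M.attempts : ℝ≥0∞) ^ 2 + expect (A e) fun k => (k : ℝ≥0∞) ^ 2) := by
  set R := ∑ e, (x e : ℝ≥0∞) ^ 2 + 2 * ∑ e, (x e : ℝ≥0∞) * lam e
        + ∑ e, ((M.attempts : ℝ≥0∞) ^ 2 + expect (A e) fun k => (k : ℝ≥0∞) ^ 2) with hR
  have hRn : (expect (indepLaw A) fun n => ∑ e, (x e : ℝ≥0∞) ^ 2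
      + 2 * ∑ e, (x e : ℝ≥0∞) * n e + ∑ e, ((M.attempts : ℝ≥0∞) ^ 2 + (n e : ℝ≥0∞) ^ 2)) = R := by
    simp only [expect_add, expect_const, expect_const_mul, expect_arrivals h, expect_finset_sum]
    congr 1
    exact Finset.sum_congr rfl fun e _ => by
      rw [expect_indepLaw A e fun k => (k : ℝ≥0∞) ^ 2]
  rw [expect_queueStep, meanService, ← expect_const_mul, ← expect_add]
  refine expect_le_of_le fun a ha => ?_
  rw [← expect_const_mul, ← expect_add]
  refine expect_le_of_le fun w hw => ?_
  rw [← expect_departures M (fun e => min (w e) (x e)), ← expect_const_mul, ← expect_add]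
  refine expect_le_of_le fun d hd => ?_
  rw [← expect_const (indepLaw A) (2 * _), ← expect_add, ← hRn]
  refine expect_mono fun n => ?_
  simp only [Finset.mul_sum, ← Finset.sum_add_distrib]
  refine Finset.sum_le_sum fun e _ => ?_
  have hdx := (departure_le hd e).trans (min_le_right _ _)
  have hdL : d e ≤ M.attempts := ((departure_le hd e).trans (min_le_left _ _)).trans
    ((le_of_mem_feasible (hW x a w hw).1 e).trans (le_attempts_of_mem_support ha _))
  -- With `x = d + k` the truncated difference becomes `k`; the inequality then needs only `d² ≤
  -- M.attempts²` and the sign of the mixed term `2 d n`.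
  obtain ⟨k, hk⟩ := Nat.exists_eq_add_of_le hdx
  norm_cast
  rw [hk, Nat.add_sub_cancel_left]
  nlinarith

/-! ### Sufficiency -/

/-- The mean service of the pair `e` under the weights `b`, as in the definition of `Λ^PS`. -/
def serviceRate (M : Switch K) (b : (Fin K → ℕ) → PairVec K → ℝ) (e : Pair K) : ℝ :=
  ∑ a ∈ M.availStates with a ≠ 0,
    (M.availLaw a).toReal * ∑ π ∈ feasible a, b a π * ((M.q e : ℝ) * (π e : ℝ))

theorem sum_mul_serviceRate (M : Switch K) (b : (Fin K → ℕ) → PairVec K → ℝ) (c : Pair K → ℝ) :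
    ∑ e, c e * serviceRate M b e = ∑ a ∈ M.availStates with a ≠ 0,
      (M.availLaw a).toReal * ∑ π ∈ feasible a, b a π * weight M π c := by
  simp only [serviceRate, weight, Finset.mul_sum]
  rw [Finset.sum_comm]
  refine Finset.sum_congr rfl fun a _ => ?_
  rw [Finset.sum_comm]
  exact Finset.sum_congr rfl fun π _ => Finset.sum_congr rfl fun e _ => by ring

/-- Rate vectors in `Λ^PS` are dominated by the mean maximal weight with some slack. -/
theorem exists_slack_of_mem_LambdaPS (hq : ∀ e : Pair K, 0 < (M.q e : ℝ))
    (hT : ∀ i : Fin K, M.purifiedLaw i 0 ≠ 1) (hlam : lam ∈ LambdaPS M) :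
    ∃ ε : ℝ, 0 < ε ∧ ∀ c : Pair K → ℝ, (∀ e, 0 ≤ c e) →
      ∑ e, c e * lam e + ε * ∑ e, c e ≤ meanWeight M c := by
  obtain ⟨b, hb, hle⟩ := hlam
  obtain ⟨a₀, ha₀, ha1⟩ := exists_mem_support_availLaw hT
  have hne : M.availStates.Nonempty := ⟨a₀, mem_availStates_of_mem_support ha₀⟩
  -- There are finitely many availability states, so the total weights are bounded uniformly by some
  -- `s < 1`, and `(1 - s) * meanWeight M c` is left as slack.
  obtain ⟨a₁, ha₁, hmax⟩ := Finset.exists_max_image M.availStates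
    (fun a => ∑ π ∈ feasible a, b a π) hne
  set s := ∑ π ∈ feasible a₁, b a₁ π
  have hs1 : s < 1 := (hb a₁ ha₁).2
  have hP0 : 0 < (M.availLaw a₀).toReal :=
    ENNReal.toReal_pos ha₀ (PMF.apply_ne_top _ _)
  -- Serving the pair `e` alone is feasible for `a₀`, so `c e ≤ (q e)⁻¹ * maxWeight M a₀ c`, and
  -- summation gives the constant. The additional 1 keeps `r` positive when there are no pairs.
  set r : ℝ := 1 + ∑ e, (M.q e : ℝ)⁻¹
  have hr : 0 < r := by
    have : 0 ≤ ∑ e, (M.q e : ℝ)⁻¹ := Finset.sum_nonneg fun e _ => inv_nonneg.2 (hq e).le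
    linarith
  refine ⟨(1 - s) * ((M.availLaw a₀).toReal / r),
    mul_pos (sub_pos.2 hs1) (div_pos hP0 hr), fun c hc => ?_⟩
  have h1 : ∑ e, c e * lam e ≤ s * meanWeight M c := by
    calc ∑ e, c e * lam e
        ≤ ∑ e, c e * serviceRate M b e :=
          Finset.sum_le_sum fun e _ => mul_le_mul_of_nonneg_left (hle e) (hc e)
      _ = _ := sum_mul_serviceRate M b c
      _ ≤ ∑ a ∈ M.availStates with a ≠ 0, (M.availLaw a).toReal * (s * maxWeight M a c) := by
          refine Finset.sum_le_sum fun a ha => mul_le_mul_of_nonneg_left ?_ ENNReal.toReal_nonneg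
          have ha' := (Finset.mem_filter.1 ha).1
          calc ∑ π ∈ feasible a, b a π * weight M π c
              ≤ ∑ π ∈ feasible a, b a π * maxWeight M a c :=
                Finset.sum_le_sum fun π hπ => mul_le_mul_of_nonneg_left
                  (weight_le_maxWeight hπ c) ((hb a ha').1 π hπ).le
            _ = (∑ π ∈ feasible a, b a π) * maxWeight M a c := by rw [Finset.sum_mul]
            _ ≤ s * maxWeight M a c :=
                mul_le_mul_of_nonneg_right (hmax a ha') (maxWeight_nonneg M a c)
      _ ≤ ∑ a ∈ M.availStates, (M.availLaw a).toReal * (s * maxWeight M a c) := by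
          refine Finset.sum_le_sum_of_subset_of_nonneg (Finset.filter_subset _ _) fun a _ _ => ?_
          have hs0 : 0 ≤ s := Finset.sum_nonneg fun π hπ => ((hb a₁ ha₁).1 π hπ).le
          exact mul_nonneg ENNReal.toReal_nonneg (mul_nonneg hs0 (maxWeight_nonneg M a c))
      _ = s * meanWeight M c := by
          rw [meanWeight, Finset.mul_sum]
          exact Finset.sum_congr rfl fun a _ => by ring
  have h2 : (M.availLaw a₀).toReal / r * ∑ e, c e ≤ meanWeight M c := by
    have h3 : ∑ e, c e ≤ r * maxWeight M a₀ c := by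
      calc ∑ e, c e ≤ ∑ e, (M.q e : ℝ)⁻¹ * maxWeight M a₀ c := by
            refine Finset.sum_le_sum fun e _ => ?_
            rw [← div_eq_inv_mul, le_div_iff₀ (hq e), mul_comm]
            exact mul_le_maxWeight ha1 c e
        _ = (∑ e, (M.q e : ℝ)⁻¹) * maxWeight M a₀ c := by rw [Finset.sum_mul]
        _ ≤ r * maxWeight M a₀ c :=
            mul_le_mul_of_nonneg_right (le_add_of_nonneg_left zero_le_one)
              (maxWeight_nonneg M a₀ c)
    calc (M.availLaw a₀).toReal / r * ∑ e, c e
        ≤ (M.availLaw a₀).toReal / r * (r * maxWeight M a₀ c) :=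
          mul_le_mul_of_nonneg_left h3 (div_pos hP0 hr).le
      _ = (M.availLaw a₀).toReal * maxWeight M a₀ c := by field_simp
      _ ≤ meanWeight M c :=
          Finset.single_le_sum (f := fun a => (M.availLaw a).toReal * maxWeight M a c)
            (fun a _ => mul_nonneg ENNReal.toReal_nonneg (maxWeight_nonneg M a c))
            (mem_availStates_of_mem_support ha₀)
  have h4 := mul_le_mul_of_nonneg_left h2 (sub_pos.2 hs1).le
  linarith [mul_assoc (1 - s) ((M.availLaw a₀).toReal / r) (∑ e, c e)]

/-- The slack is used at `c = x`: max-weight service then outweighs the arrivals in the first-order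
part of the drift of `∑ x²`. -/
theorem drift_queueStep (hW : IsMaxWeight M W) (hA : FiniteSecondMoments A) (h : HasRates A lam)
    {ε : ℝ} (hε : 0 < ε) (hslack : ∀ c : Pair K → ℝ, (∀ e, 0 ≤ c e) →
      ∑ e, c e * lam e + ε * ∑ e, c e ≤ meanWeight M c) :
    Drift (queueStep M W A) (fun x => ∑ e, (x e : ℝ≥0∞) ^ 2)
      (fun x => 2 * (ENNReal.ofReal ε * ∑ e, (x e : ℝ≥0∞)))
      (∑ e, ((M.attempts : ℝ≥0∞) ^ 2 + expect (A e) fun k => (k : ℝ≥0∞) ^ 2)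
        + 2 * ∑ _e : Pair K, (M.attempts : ℝ≥0∞) ^ 2) where
  ne_top x := by simp [ENNReal.sum_eq_top]
  bound_ne_top := by
    simp [ENNReal.sum_eq_top, ENNReal.mul_eq_top, hA.expect_sq_ne_top]
  drift x := by
    have h1 := expect_queueStep_sq_le hW h x
    have h2 := ofReal_meanWeight_le_meanService hW x
    have h3 : ∑ e, (x e : ℝ≥0∞) * lam e + ENNReal.ofReal ε * ∑ e, (x e : ℝ≥0∞)
        ≤ ENNReal.ofReal (meanWeight M fun e => (x e : ℝ)) := by
      refine le_trans (le_of_eq ?_) (ENNReal.ofReal_le_ofReal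
        (hslack (fun e => (x e : ℝ)) fun e => Nat.cast_nonneg _))
      rw [ENNReal.ofReal_add (by positivity) (by positivity), ENNReal.ofReal_mul hε.le,
        ENNReal.ofReal_sum_of_nonneg (fun e _ => by positivity),
        ENNReal.ofReal_sum_of_nonneg (fun e _ => by positivity)]
      simp [ENNReal.ofReal_mul]
    set X := ∑ e, (x e : ℝ≥0∞) * lam e with hX
    have hXt : 2 * X ≠ ∞ := by
      simp [hX, ENNReal.sum_eq_top, ENNReal.mul_eq_top]
    -- The finite arrival term `2 X` is added on both sides and cancels at the end, in place of a
    -- subtraction.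
    refine (ENNReal.add_le_add_iff_right hXt).1 ?_
    set L2 := ∑ _e : Pair K, (M.attempts : ℝ≥0∞) ^ 2
    calc _ = (expect (queueStep M W A x) fun u => ∑ e, (u e : ℝ≥0∞) ^ 2)
          + 2 * (X + ENNReal.ofReal ε * ∑ e, (x e : ℝ≥0∞)) := by ring
      _ ≤ (expect (queueStep M W A x) fun u => ∑ e, (u e : ℝ≥0∞) ^ 2)
          + 2 * (meanService M W x (fun e => (x e : ℝ≥0∞)) + L2) :=
          add_le_add le_rfl (mul_le_mul' le_rfl (h3.trans h2))
      _ = (expect (queueStep M W A x) fun u => ∑ e, (u e : ℝ≥0∞) ^ 2)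
          + 2 * meanService M W x (fun e => (x e : ℝ≥0∞)) + 2 * L2 := by ring
      _ ≤ _ := add_le_add_left h1 _
      _ = _ := by ring
  finite R hR := by
    have hε' : ENNReal.ofReal ε ≠ 0 := by simpa using hε
    set N := ⌊(R / ENNReal.ofReal ε).toReal⌋₊
    refine (Set.finite_Iic (fun _ : Pair K => N)).subset fun x hx e => ?_
    refine Nat.le_floor ?_
    have h1 : (x e : ℝ≥0∞) * ENNReal.ofReal ε ≤ R := by
      calc (x e : ℝ≥0∞) * ENNReal.ofReal ε ≤ ENNReal.ofReal ε * ∑ e, (x e : ℝ≥0∞) := by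
            rw [mul_comm]
            gcongr
            exact Finset.single_le_sum (f := fun e => (x e : ℝ≥0∞)) (fun _ _ => bot_le)
              (Finset.mem_univ e)
        _ ≤ 2 * (ENNReal.ofReal ε * ∑ e, (x e : ℝ≥0∞)) := by
            rw [two_mul]; exact le_self_add
        _ ≤ R := hx
    have h2 := ENNReal.toReal_mono (ENNReal.div_ne_top hR hε')
      ((ENNReal.le_div_iff_mul_le (Or.inl hε') (Or.inl (by simp))).2 h1)
    simpa using h2

theorem stable_of_mem_LambdaPS (hq : ∀ e : Pair K, 0 < (M.q e : ℝ))
    (hT : ∀ i : Fin K, M.purifiedLaw i 0 ≠ 1) (hW : IsMaxWeight M W) (h : HasRates A lam)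
    (hA : Admissible M W A) (hlam : lam ∈ LambdaPS M) : Stable M W A := by
  obtain ⟨ε, hε, hslack⟩ := exists_slack_of_mem_LambdaPS hq hT hlam
  have hd := drift_queueStep hW hA.1 h hε hslack
  obtain ⟨π, hf, hconv⟩ := hd.ergodic hA.2
  refine stable_of_tendsto_expect (fun e => ?_) hconv
  have h1 := ne_top_of_le_ne_top hd.bound_ne_top hf
  simp only [expect_const_mul, expect_finset_sum] at h1
  intro htop
  refine h1 ?_
  rw [(ENNReal.sum_eq_top (s := Finset.univ)).2 ⟨e, Finset.mem_univ e, htop⟩,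
    ENNReal.mul_top (by simpa using hε), ENNReal.mul_top (by simp)]

end Sufficiency

/-! ### From stability to `Λ^PS`: separation and a conserved functional -/

section Necessity

variable {K : ℕ} {M : Switch K} {W : Policy K} {A : Pair K → PMF ℕ} {lam : Pair K → ℝ≥0}

/-! ### Separation of rate vectors outside of `Λ^PS` -/

/-- The conditions on the weights in the definition of `Λ^PS`. -/
def IsSchedulingWeight (M : Switch K) (b : (Fin K → ℕ) → PairVec K → ℝ) : Prop :=
  ∀ a ∈ M.availStates, (∀ π ∈ feasible a, 0 < b a π) ∧ ∑ π ∈ feasible a, b a π < 1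

/-- The uniform distribution on the feasible schedules, halved. -/
def halfUniform (a : Fin K → ℕ) (_ : PairVec K) : ℝ := (2 * ((feasible a).card : ℝ))⁻¹

theorem card_feasible_pos (a : Fin K → ℕ) : 0 < ((feasible a).card : ℝ) :=
  Nat.cast_pos.2 (Finset.card_pos.2 ⟨0, zero_mem_feasible a⟩)

theorem halfUniform_pos (a : Fin K → ℕ) (π : PairVec K) : 0 < halfUniform a π :=
  inv_pos.2 (mul_pos two_pos (card_feasible_pos a))

theorem sum_halfUniform (a : Fin K → ℕ) : ∑ π ∈ feasible a, halfUniform a π = 1 / 2 := by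
  have := card_feasible_pos a
  simp only [halfUniform, Finset.sum_const, nsmul_eq_mul]
  field_simp

theorem isSchedulingWeight_halfUniform : IsSchedulingWeight M halfUniform := fun a _ =>
  ⟨fun π _ => halfUniform_pos a π, by rw [sum_halfUniform]; norm_num⟩

/-- The rate vectors strictly below the service rates of some weights. -/
def openRegion (M : Switch K) : Set (Pair K → ℝ) :=
  ⋃ b ∈ {b | IsSchedulingWeight M b}, Set.pi Set.univ fun e => Set.Iio (serviceRate M b e)

theorem mem_openRegion {v : Pair K → ℝ} :
    v ∈ openRegion M ↔ ∃ b, IsSchedulingWeight M b ∧ ∀ e, v e < serviceRate M b e := by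
  simp [openRegion]

theorem isOpen_openRegion : IsOpen (openRegion M) :=
  isOpen_biUnion fun _ _ => isOpen_set_pi Set.finite_univ fun _ _ => isOpen_Iio

theorem serviceRate_add_mul (b b' : (Fin K → ℕ) → PairVec K → ℝ) (s t : ℝ) (e : Pair K) :
    serviceRate M (fun a π => s * b a π + t * b' a π) e
      = s * serviceRate M b e + t * serviceRate M b' e := by
  simp only [serviceRate, Finset.mul_sum, ← Finset.sum_add_distrib]
  exact Finset.sum_congr rfl fun a _ => Finset.sum_congr rfl fun π _ => by ring

theorem convex_openRegion : Convex ℝ (openRegion M) := by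
  rw [convex_iff_forall_pos]
  intro v hv v' hv' s t hs ht hst
  obtain ⟨b, hb, hvb⟩ := mem_openRegion.1 hv
  obtain ⟨b', hb', hvb'⟩ := mem_openRegion.1 hv'
  refine mem_openRegion.2 ⟨fun a π => s * b a π + t * b' a π, fun a ha => ⟨fun π hπ => ?_, ?_⟩,
    fun e => ?_⟩
  · exact add_pos (mul_pos hs ((hb a ha).1 π hπ)) (mul_pos ht ((hb' a ha).1 π hπ))
  · rw [Finset.sum_add_distrib, ← Finset.mul_sum, ← Finset.mul_sum]
    nlinarith [(hb a ha).2, (hb' a ha).2]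
  · rw [serviceRate_add_mul]
    simp only [Pi.add_apply, Pi.smul_apply, smul_eq_mul]
    nlinarith [hvb e, hvb' e]

theorem maxWeight_zero_left (c : Pair K → ℝ) : maxWeight M 0 c = 0 := by
  obtain ⟨π, hπ, h⟩ := exists_weight_eq_maxWeight M 0 c
  rw [← h, weight]
  refine Finset.sum_eq_zero fun e _ => ?_
  have h0 : π e = 0 := Nat.le_zero.1 (le_of_mem_feasible hπ e)
  simp [h0]

/-- A linear functional that bounds the service rates of all weights bounds the mean maximal
weight. -/
theorem meanWeight_le_of_serviceRate_le {c : Pair K → ℝ} (hc : ∀ e, 0 ≤ c e) {m : ℝ}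
    (h : ∀ b, IsSchedulingWeight M b → ∑ e, c e * serviceRate M b e ≤ m) :
    meanWeight M c ≤ m := by
  classical
  choose s hs hsmax using fun a => exists_weight_eq_maxWeight M a c
  have hpos : ∀ π : PairVec K, 0 ≤ weight M π c := fun π =>
    Finset.sum_nonneg fun e _ => mul_nonneg (mul_nonneg (Nat.cast_nonneg _) (M.q e).2.1) (hc e)
  have hη : ∀ η : ℝ, 0 < η → η < 1 → (1 - η) * meanWeight M c ≤ m := by
    intro η h0 h1
    -- Nearly all weight goes to a maximizer. The admixture `η * halfUniform` makes every weight
    -- positive and brings the total to `1 - η / 2 < 1`.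
    set b : (Fin K → ℕ) → PairVec K → ℝ :=
      fun a π => (if π = s a then 1 - η else 0) + η * halfUniform a π with hb
    have hb0 : ∀ a π, 0 < b a π := fun a π => by
      refine add_pos_of_nonneg_of_pos ?_ (mul_pos h0 (halfUniform_pos a π))
      split_ifs
      · linarith
      · exact le_rfl
    refine le_trans ?_ (h b fun a _ => ⟨fun π _ => hb0 a π, ?_⟩)
    · rw [sum_mul_serviceRate, meanWeight, Finset.mul_sum, Finset.sum_filter]
      refine Finset.sum_le_sum fun a _ => ?_
      split_ifs with ha
      · rw [mul_left_comm]
        refine mul_le_mul_of_nonneg_left ?_ ENNReal.toReal_nonneg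
        calc (1 - η) * maxWeight M a c ≤ b a (s a) * weight M (s a) c := by
              rw [hsmax a]
              refine mul_le_mul_of_nonneg_right ?_ (maxWeight_nonneg M a c)
              simpa [hb] using (mul_pos h0 (halfUniform_pos a (s a))).le
          _ ≤ _ := Finset.single_le_sum (f := fun π => b a π * weight M π c)
              (fun π _ => mul_nonneg (hb0 a π).le (hpos π)) (hs a)
      -- Leaving out `a = 0` in the service rates loses nothing: only the zero schedule is feasible
      -- there.
      · rw [not_not] at ha
        rw [ha, maxWeight_zero_left, mul_zero, mul_zero]
    · rw [hb]
      simp only [Finset.sum_add_distrib, ← Finset.mul_sum, sum_halfUniform, Finset.sum_ite_eq',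
        hs a, if_true]
      linarith
  refine le_of_forall_pos_le_add fun ε hε => ?_
  have hm0 := meanWeight_nonneg M c
  have hd : 0 < meanWeight M c + 1 := by linarith
  have h1 := hη (min (1 / 2) (ε / (meanWeight M c + 1))) (lt_min (by norm_num) (div_pos hε hd))
    ((min_le_left _ _).trans_lt (by norm_num))
  have h2 : min (1 / 2) (ε / (meanWeight M c + 1)) * meanWeight M c ≤ ε := by
    calc _ ≤ ε / (meanWeight M c + 1) * (meanWeight M c + 1) :=
          mul_le_mul (min_le_right _ _) (by linarith) hm0 (div_pos hε hd).le
      _ = ε := div_mul_cancel₀ _ hd.ne'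
  linarith

/-- Rate vectors outside of `Λ^PS` are separated from it. -/
theorem exists_meanWeight_le_of_notMem_LambdaPS (hlam : lam ∉ LambdaPS M) :
    ∃ c : Pair K → ℝ≥0, (∃ e, c e ≠ 0) ∧
      (meanWeight M fun e => (c e : ℝ)) ≤ ∑ e, (c e : ℝ) * lam e := by
  classical
  have hnot : (fun e => (lam e : ℝ)) ∉ openRegion M := by
    intro h
    obtain ⟨b, hb, hle⟩ := mem_openRegion.1 h
    exact hlam ⟨b, hb, fun e => (hle e).le⟩
  obtain ⟨f, hf⟩ := geometric_hahn_banach_open_point convex_openRegion isOpen_openRegion hnot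
  set c : Pair K → ℝ := fun e => f (Pi.single e 1) with hc
  have hfc : ∀ v : Pair K → ℝ, f v = ∑ e, c e * v e := by
    intro v
    have := f.toLinearMap.pi_apply_eq_sum_univ v
    simp only [ContinuousLinearMap.coe_coe, smul_eq_mul] at this
    rw [this]
    refine Finset.sum_congr rfl fun e _ => ?_
    rw [mul_comm, hc]
    congr 2
    funext e'
    simp [Pi.single_apply, eq_comm]
  have hlow : ∀ b, IsSchedulingWeight M b → ∀ δ : Pair K → ℝ, (∀ e, 0 < δ e) →
      ∑ e, c e * (serviceRate M b e - δ e) < ∑ e, c e * lam e := by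
    intro b hb δ hδ
    rw [← hfc fun e => (lam e : ℝ), ← hfc fun e => serviceRate M b e - δ e]
    exact hf _ (mem_openRegion.2 ⟨b, hb, fun e => sub_lt_self _ (hδ e)⟩)
  have hc0 : ∀ e, 0 ≤ c e := by
    intro e
    by_contra! hneg
    -- The region is closed under lowering coordinates. If `c e` were negative, lowering coordinate
    -- `e` by this `t` would raise the functional to at least its value at `lam`.
    set t : ℝ := |∑ e, c e * lam e - ∑ e, c e * (serviceRate M halfUniform e - 1)| / (-c e)
    have ht : 0 ≤ t := div_nonneg (abs_nonneg _) (by linarith)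
    have h1 := hlow halfUniform isSchedulingWeight_halfUniform
      (fun e' => 1 + (Pi.single e t : Pair K → ℝ) e') fun e' => by
        have : 0 ≤ (Pi.single e t : Pair K → ℝ) e' := by
          rw [Pi.single_apply]; split_ifs <;> simp [ht]
        linarith
    have h2 : ∑ e', c e' * (serviceRate M halfUniform e' - (1 + (Pi.single e t : Pair K → ℝ) e'))
        = ∑ e, c e * (serviceRate M halfUniform e - 1) + t * (-c e) := by
      have h3 : ∀ e', c e' * (serviceRate M halfUniform e' - (1 + (Pi.single e t : Pair K → ℝ) e'))
          = c e' * (serviceRate M halfUniform e' - 1) - c e' * (Pi.single e t : Pair K → ℝ) e' :=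
        fun e' => by ring
      rw [Finset.sum_congr rfl fun e' _ => h3 e', Finset.sum_sub_distrib]
      simp only [Pi.single_apply, mul_ite, mul_zero, Finset.sum_ite_eq', Finset.mem_univ, if_true]
      ring
    rw [h2, div_mul_cancel₀ _ (by linarith)] at h1
    linarith [le_abs_self (∑ e, c e * lam e - ∑ e, c e * (serviceRate M halfUniform e - 1))]
  have hle : ∀ b, IsSchedulingWeight M b →
      ∑ e, c e * serviceRate M b e ≤ ∑ e, c e * lam e := by
    intro b hb
    refine le_of_forall_pos_le_add fun ε hε => ?_
    have hs : 0 ≤ ∑ e, c e := Finset.sum_nonneg fun e _ => hc0 e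
    have hs1 : 0 < ∑ e, c e + 1 := by linarith
    have h1 := hlow b hb (fun _ => ε / (∑ e, c e + 1)) fun _ => div_pos hε hs1
    simp only [mul_sub, Finset.sum_sub_distrib, ← Finset.sum_mul] at h1
    have h2 : (∑ e, c e) * (ε / (∑ e, c e + 1)) ≤ ε := by
      rw [mul_div_assoc', div_le_iff₀ hs1]
      nlinarith
    linarith
  refine ⟨fun e => ⟨c e, hc0 e⟩, ?_, meanWeight_le_of_serviceRate_le hc0 hle⟩
  -- The separation is strict on the nonempty open region, so the functional cannot vanish.
  by_contra! hzero
  have hz : ∀ e, c e = 0 := fun e => congrArg NNReal.toReal (hzero e)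
  have := hlow halfUniform isSchedulingWeight_halfUniform (fun _ => 1) fun _ => one_pos
  simp [hz] at this

/-! ### Necessity -/

theorem sum_mul_eq_ofReal (c v : Pair K → ℝ≥0) :
    ∑ e, (c e : ℝ≥0∞) * (v e : ℝ≥0∞) = ENNReal.ofReal (∑ e, (c e : ℝ) * v e) := by
  rw [ENNReal.ofReal_sum_of_nonneg fun e _ => by positivity]
  exact Finset.sum_congr rfl fun e _ => by
    rw [ENNReal.ofReal_mul (NNReal.coe_nonneg _), ENNReal.ofReal_coe_nnreal,
      ENNReal.ofReal_coe_nnreal]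

theorem sum_mul_natCast_eq_ofReal (c : Pair K → ℝ≥0) (v : PairVec K) :
    ∑ e, (c e : ℝ≥0∞) * (v e : ℝ≥0∞) = ENNReal.ofReal (∑ e, (c e : ℝ) * v e) := by
  simpa using sum_mul_eq_ofReal c fun e => (v e : ℝ≥0)

/-- In the weights `c`, mean arrivals are at least the best possible mean service, so the weighted
queue length is a submartingale. -/
theorem le_expect_queueStep (hW : IsMaxWeight M W) (h : HasRates A lam) {c : Pair K → ℝ≥0}
    (hc : (meanWeight M fun e => (c e : ℝ)) ≤ ∑ e, (c e : ℝ) * lam e) (x : PairVec K) :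
    ∑ e, (c e : ℝ≥0∞) * (x e : ℝ≥0∞)
      ≤ expect (queueStep M W A x) fun u => ∑ e, (c e : ℝ≥0∞) * (u e : ℝ≥0∞) := by
  have h1 := expect_queueStep_linear (M := M) (W := W) h x fun e => c e
  have h2 := (meanService_le hW x c).trans (ENNReal.ofReal_le_ofReal hc)
  rw [← sum_mul_eq_ofReal] at h2
  have hfin : ∑ e, (c e : ℝ≥0∞) * (lam e : ℝ≥0∞) ≠ ∞ := by
    rw [sum_mul_eq_ofReal]; exact ENNReal.ofReal_ne_top
  refine (ENNReal.add_le_add_iff_right hfin).1 ?_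
  rw [← h1]
  gcongr

theorem mem_LambdaPS_of_stable (hq : ∀ e : Pair K, 0 < (M.q e : ℝ))
    (hT : ∀ i : Fin K, M.purifiedLaw i 0 ≠ 1) (hW : IsMaxWeight M W) (h : HasRates A lam)
    (hA : IrreducibleAperiodic (queueStep M W A)) (hst : Stable M W A) : lam ∈ LambdaPS M := by
  classical
  by_contra hlam
  obtain ⟨c, ⟨e₀, he₀⟩, hmean⟩ := exists_meanWeight_le_of_notMem_LambdaPS hlam
  obtain ⟨π, hπ, hfin⟩ := exists_stationary_of_stable hst
  have hq1 : ∀ e, ¬ (M.q e : ℝ) < 1 → (M.q e : ℝ) = 1 := fun e he =>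
    le_antisymm (M.q e).2.2 (not_lt.1 he)
  -- the weighted queue length is constant along the stationary chain
  have hconst := eq_of_stationary_of_subharmonic hπ
    (h := fun x => ∑ e, (c e : ℝ≥0∞) * (x e : ℝ≥0∞))
    (by
      simp only [expect_finset_sum, expect_const_mul]
      exact ENNReal.sum_ne_top.2 fun e _ => ENNReal.mul_ne_top ENNReal.coe_ne_top (hfin e))
    fun x _ => le_expect_queueStep hW h hmean x
  -- Departures and arrivals can be combined freely, so a conserved weighted queue length makes each
  -- possible weighted departure equal to each possible weighted arrival. Both are therefore one
  -- constant, called `m` below.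
  have hbal : ∀ x ∈ π.support, ∀ a ∈ M.availLaw.support, ∀ w ∈ (W x a).support,
      ∀ d : PairVec K, (∀ e, d e ∈ (binomialLaw (min (w e) (x e)) (M.q e)).support) →
      ∀ n : PairVec K, (∀ e, n e ∈ (A e).support) →
      ∑ e, (c e : ℝ) * d e = ∑ e, (c e : ℝ) * n e := by
    intro x hx a ha w hw d hd n hn
    have h1 := hconst x hx _ (mem_support_queueStep.2 ⟨a, ha, w, hw, d, hd, n, hn, rfl⟩)
    have h2 : ∑ e, (c e : ℝ) * ((x e - d e + n e : ℕ) : ℝ) = ∑ e, (c e : ℝ) * x e := by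
      rw [sum_mul_natCast_eq_ofReal, sum_mul_natCast_eq_ofReal] at h1
      exact (ENNReal.ofReal_eq_ofReal_iff (Finset.sum_nonneg fun e _ => by positivity)
        (Finset.sum_nonneg fun e _ => by positivity)).1 h1
    have h3 : ∀ e, (c e : ℝ) * ((x e - d e + n e : ℕ) : ℝ)
        = (c e : ℝ) * x e - c e * d e + c e * n e := by
      intro e
      have hdx : d e ≤ x e := (le_of_mem_support_binomialLaw (hd e)).trans (min_le_right _ _)
      push_cast [Nat.cast_sub hdx]
      ring
    simp only [h3, Finset.sum_add_distrib, Finset.sum_sub_distrib] at h2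
    linarith
  have hself : ∀ x w : PairVec K, ∀ e,
      min (w e) (x e) ∈ (binomialLaw (min (w e) (x e)) (M.q e)).support :=
    fun x w e => self_mem_support_binomialLaw _ (hq e)
  obtain ⟨x₀, hx₀⟩ := π.support_nonempty
  obtain ⟨a₀, ha₀, ha1⟩ := exists_mem_support_availLaw hT
  obtain ⟨w₀, hw₀⟩ := (W x₀ a₀).support_nonempty
  choose n₀ hn₀ using fun e => (A e).support_nonempty
  set m : ℝ := ∑ e, (c e : ℝ) * n₀ e with hm
  have hd : ∀ x ∈ π.support, ∀ a ∈ M.availLaw.support, ∀ w ∈ (W x a).support,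
      ∀ d : PairVec K, (∀ e, d e ∈ (binomialLaw (min (w e) (x e)) (M.q e)).support) →
      ∑ e, (c e : ℝ) * d e = m :=
    fun x hx a ha w hw d hd => hbal x hx a ha w hw d hd n₀ hn₀
  have hn : ∀ n : PairVec K, (∀ e, n e ∈ (A e).support) → ∑ e, (c e : ℝ) * n e = m :=
    fun n hn => (hbal x₀ hx₀ a₀ ha₀ w₀ hw₀ _ (hself x₀ w₀) n hn).symm.trans
      (hbal x₀ hx₀ a₀ ha₀ w₀ hw₀ _ (hself x₀ w₀) n₀ hn₀)
  have hlam_m : ∑ e, (c e : ℝ) * lam e = m := by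
    have h1 := expect_arrivals h fun e => (c e : ℝ≥0∞)
    have h2 : (expect (indepLaw A) fun n => ∑ e, (c e : ℝ≥0∞) * (n e : ℝ≥0∞))
        = ∑ e, (c e : ℝ≥0∞) * (n₀ e : ℝ≥0∞) := by
      rw [← expect_const (indepLaw A) (∑ e, (c e : ℝ≥0∞) * (n₀ e : ℝ≥0∞))]
      refine expect_congr_of_support fun n hn' => ?_
      rw [sum_mul_natCast_eq_ofReal, sum_mul_natCast_eq_ofReal,
        hn n (mem_support_indepLaw.1 hn')]
    rw [h2, sum_mul_eq_ofReal, sum_mul_natCast_eq_ofReal] at h1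
    exact ((ENNReal.ofReal_eq_ofReal_iff (Finset.sum_nonneg fun e _ => by positivity)
      (Finset.sum_nonneg fun e _ => by positivity)).1 h1).symm
  -- pairs with random departures are not served
  have hidle : ∀ x ∈ π.support, ∀ a ∈ M.availLaw.support, ∀ w ∈ (W x a).support, ∀ e,
      (M.q e : ℝ) < 1 → (c e : ℝ) * (min (w e) (x e) : ℕ) = 0 := by
    intro x hx a ha w hw e he
    have h1 := hd x hx a ha w hw _ (hself x w)
    -- When `q e < 1`, both full success and total failure of the swaps of `e` are possible;
    -- comparing the two leaves no room for attempted swaps when `c e > 0`.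
    have h2 := hd x hx a ha w hw (Function.update (fun e => min (w e) (x e)) e 0) fun e' => by
      by_cases hee : e' = e
      · subst hee
        simpa using zero_mem_support_binomialLaw (min (w e') (x e')) he
      · simpa [hee] using hself x w e'
    rw [← Finset.add_sum_erase _ _ (Finset.mem_univ e)] at h1 h2
    have h3 : ∑ e' ∈ Finset.univ.erase e,
          (c e' : ℝ) * (Function.update (fun e => min (w e) (x e)) e 0 e' : ℕ)
        = ∑ e' ∈ Finset.univ.erase e, (c e' : ℝ) * (min (w e') (x e') : ℕ) :=
      Finset.sum_congr rfl fun e' he' => by simp [Finset.ne_of_mem_erase he']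
    rw [h3] at h2
    simp only [Function.update_self, Nat.cast_zero, mul_zero] at h2
    linarith
  -- The attempted swaps have weight `m`: the factor `q` can be dropped, since pairs with `q < 1`
  -- contribute zero.
  have hge : ∀ a ∈ M.availLaw.support, m ≤ maxWeight M a fun e => (c e : ℝ) := by
    intro a ha
    obtain ⟨w, hw⟩ := (W x₀ a).support_nonempty
    refine le_trans (le_of_eq ?_) (weight_le_maxWeight
      (feasible_mono (w' := fun e => min (w e) (x₀ e)) (hW x₀ a w hw).1 fun e => min_le_left _ _) _)
    rw [← hd x₀ hx₀ a ha w hw _ (hself x₀ w), weight]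
    refine Finset.sum_congr rfl fun e _ => ?_
    by_cases he : (M.q e : ℝ) < 1
    · have := hidle x₀ hx₀ a ha w hw e he
      rw [this, mul_right_comm, mul_comm _ (c e : ℝ), this, zero_mul]
    · rw [hq1 e he]; ring
  have hm0 : 0 ≤ m := Finset.sum_nonneg fun e _ => by positivity
  -- The maximal weight is at least `m` on the support and its mean is at most `m`.
  have hmax : ∀ a ∈ M.availLaw.support, (maxWeight M a fun e => (c e : ℝ)) = m := by
    intro a ha
    have h1 := eq_on_support_of_expect_le (p := M.availLaw) (f := fun _ => ENNReal.ofReal m)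
      (g := fun a => ENNReal.ofReal (maxWeight M a fun e => (c e : ℝ)))
      (fun a ha => ENNReal.ofReal_le_ofReal (hge a ha))
      (by
        rw [expect_maxWeight, expect_const]
        exact ENNReal.ofReal_le_ofReal (hmean.trans_eq hlam_m))
      (by rw [expect_const]; exact ENNReal.ofReal_ne_top) a ha
    exact ((ENNReal.ofReal_eq_ofReal_iff hm0 (maxWeight_nonneg _ _ _)).1 h1).symm
  have hmpos : 0 < m := by
    rw [← hmax a₀ ha₀]
    refine lt_of_lt_of_le ?_ (mul_le_maxWeight ha1 _ e₀)
    exact mul_pos (hq e₀) (NNReal.coe_pos.2 (pos_iff_ne_zero.2 he₀))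
  -- pairs with random departures have no arrivals
  have hnone : ∀ e, c e ≠ 0 → (M.q e : ℝ) < 1 → ∀ k ∈ (A e).support, k = 0 := by
    intro e hce he k hk
    have hdep : ∀ x ∈ π.support, ∀ a ∈ M.availLaw.support, ∀ w ∈ (W x a).support, min (w e) (x e) = 0 := by
      intro x hx a ha w hw
      have := hidle x hx a ha w hw e he
      rcases mul_eq_zero.1 this with h0 | h0
      · exact absurd (by exact_mod_cast h0) hce
      · exact_mod_cast h0
    -- Without service the queue of `e` never decreases on the stationary support; its finite mean
    -- then makes it constant, which excludes arrivals.
    have hmono : ∀ x ∈ π.support, ∀ u ∈ (queueStep M W A x).support, x e ≤ u e := by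
      intro x hx u hu
      obtain ⟨a, ha, w, hw, d, hd', n, hn', rfl⟩ := mem_support_queueStep.1 hu
      have h0 := le_of_mem_support_binomialLaw (hd' e)
      rw [hdep x hx a ha w hw] at h0
      dsimp only
      omega
    have heq := eq_of_stationary_of_subharmonic hπ (h := fun x => (x e : ℝ≥0∞)) (hfin e)
      fun x hx => by
        rw [← expect_const (queueStep M W A x) (x e : ℝ≥0∞)]
        exact expect_mono_of_support fun u hu => by exact_mod_cast hmono x hx u hu
    have hmem := mem_support_queueStep.2 ⟨a₀, ha₀, w₀, hw₀, _, hself x₀ w₀,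
      Function.update n₀ e k, fun e' => by
        by_cases hee : e' = e
        · subst hee; simpa using hk
        · simpa [hee] using hn₀ e', rfl⟩
    have h1 := heq x₀ hx₀ _ hmem
    rw [hdep x₀ hx₀ a₀ ha₀ w₀ hw₀] at h1
    simpa using h1
  -- hence another weighted queue length never decreases
  set c' : Pair K → ℝ := fun e => if (M.q e : ℝ) < 1 then 0 else c e with hc'
  have hc'lt : ∀ e, (M.q e : ℝ) < 1 → c' e = 0 := fun e he => if_pos he
  have hc'ge : ∀ e, ¬ (M.q e : ℝ) < 1 → c' e = c e := fun e he => if_neg he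
  have hc'0 : ∀ e, 0 ≤ c' e := fun e => by
    simp only [hc']; split_ifs <;> simp
  -- This holds for every state, not only on the stationary support: departures weigh at most
  -- `maxWeight M a c' ≤ maxWeight M a c = m`, while arrivals weigh exactly `m`.
  have hmono : ∀ x : PairVec K, ∀ u ∈ (queueStep M W A x).support,
      ∑ e, c' e * x e ≤ ∑ e, c' e * u e := by
    intro x u hu
    obtain ⟨a, ha, w, hw, d, hd', n, hn', rfl⟩ := mem_support_queueStep.1 hu
    have h1 : ∑ e, c' e * d e ≤ m := by
      rw [← hmax a ha]
      calc ∑ e, c' e * d e ≤ weight M w c' := by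
            refine Finset.sum_le_sum fun e _ => ?_
            have hdw : (d e : ℝ) ≤ w e := by
              exact_mod_cast (le_of_mem_support_binomialLaw (hd' e)).trans (min_le_left _ _)
            by_cases he : (M.q e : ℝ) < 1
            · rw [hc'lt e he, zero_mul, mul_zero]
            · rw [hq1 e he, mul_one, mul_comm]
              exact mul_le_mul_of_nonneg_right hdw (hc'0 e)
        _ ≤ maxWeight M a c' := weight_le_maxWeight (hW x a w hw).1 c'
        _ ≤ _ := maxWeight_mono M a fun e => by
            simp only [hc']; split_ifs <;> simp
    have h2 : ∑ e, c' e * n e = m := by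
      rw [← hn n hn']
      refine Finset.sum_congr rfl fun e _ => ?_
      by_cases he : (M.q e : ℝ) < 1
      · by_cases hce : c e = 0
        · rw [hc'lt e he, hce, NNReal.coe_zero]
        · rw [hnone e hce he _ (hn' e), Nat.cast_zero, mul_zero, mul_zero]
      · rw [hc'ge e he]
    have h3 : ∀ e, c' e * ((x e - d e + n e : ℕ) : ℝ) = c' e * x e - c' e * d e + c' e * n e := by
      intro e
      have hdx : d e ≤ x e := (le_of_mem_support_binomialLaw (hd' e)).trans (min_le_right _ _)
      push_cast [Nat.cast_sub hdx]
      ring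
    simp only [h3, Finset.sum_add_distrib, Finset.sum_sub_distrib]
    linarith
  obtain ⟨e₁, he₁⟩ : ∃ e, 0 < c' e := by
    by_contra! hle
    have h1 := hd x₀ hx₀ a₀ ha₀ w₀ hw₀ _ (hself x₀ w₀)
    refine hmpos.ne' (h1.symm.trans (Finset.sum_eq_zero fun e _ => ?_))
    by_cases he : (M.q e : ℝ) < 1
    · exact hidle x₀ hx₀ a₀ ha₀ w₀ hw₀ e he
    · have := hle e
      rw [hc'ge e he] at this
      rw [le_antisymm this (NNReal.coe_nonneg _), zero_mul]
  obtain ⟨y, hy⟩ := hA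
  -- One additional request for `e₁` puts `z` strictly above `y` in a functional that never
  -- decreases, so `y` cannot be reached from `z`.
  set z : PairVec K := y + Pi.single e₁ 1 with hz
  have hreach : ∀ n, ∀ u ∈ (lawAt (queueStep M W A) (PMF.pure z) n).support,
      ∑ e, c' e * z e ≤ ∑ e, c' e * u e := by
    intro n
    induction n with
    | zero =>
      intro u hu
      rw [lawAt, PMF.mem_support_pure_iff] at hu
      rw [hu]
    | succ n ih =>
      intro u hu
      obtain ⟨v, hv, huv⟩ := (PMF.mem_support_bind_iff _ _ _).1 hu
      exact (ih v hv).trans (hmono v u huv)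
  obtain ⟨n, hn⟩ := (hy z).exists
  have h1 := hreach n y hn.ne'
  have h2 : ∑ e, c' e * (z e : ℝ) = ∑ e, c' e * (y e : ℝ) + c' e₁ := by
    simp [hz, mul_add, Finset.sum_add_distrib, Pi.single_apply]
  linarith

end Necessity

section CapacityRegion

variable {K : ℕ} {M : Switch K} {W : Policy K} {A : Pair K → PMF ℕ}

/-! ### Irreducibility and the capacity region -/

/-- With positive probability all links have entanglements, all swaps succeed and nothing arrives.
The maximal weight is then positive, so some pair with a nonempty queue is scheduled. -/
theorem exists_mem_support_queueStep_sum_lt (hq : ∀ e : Pair K, 0 < (M.q e : ℝ))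
    (hT : ∀ i : Fin K, M.purifiedLaw i 0 ≠ 1) (hW : IsMaxWeight M W) (hA : ∀ e, A e 0 ≠ 0)
    {x : PairVec K} (hx : x ≠ 0) :
    ∃ u ∈ (queueStep M W A x).support, ∑ e, u e < ∑ e, x e := by
  obtain ⟨e, he⟩ := Function.ne_iff.1 hx
  obtain ⟨a, ha, ha1⟩ := exists_mem_support_availLaw hT
  obtain ⟨w, hw⟩ := (W x a).support_nonempty
  have hpos : 0 < weight M w fun e => (x e : ℝ) := by
    rw [hW.weight_eq hw]
    exact (mul_pos (hq e) (Nat.cast_pos.2 (Nat.pos_of_ne_zero he))).trans_le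
      (mul_le_maxWeight ha1 (fun e => (x e : ℝ)) e)
  obtain ⟨e', -, he'⟩ := Finset.exists_ne_zero_of_sum_ne_zero hpos.ne'
  have hw' : w e' ≠ 0 := by rintro h0; simp [h0] at he'
  have hx' : x e' ≠ 0 := by rintro h0; simp [h0] at he'
  refine ⟨_, mem_support_queueStep.2 ⟨a, ha, w, hw, fun e => min (w e) (x e),
    fun e => self_mem_support_binomialLaw _ (hq e), 0, hA, rfl⟩, ?_⟩
  refine Finset.sum_lt_sum (fun e _ => ?_) ⟨e', Finset.mem_univ _, ?_⟩
  · simp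
  · simp only [Pi.zero_apply]
    omega

theorem zero_mem_support_queueStep (hq : ∀ e : Pair K, 0 < (M.q e : ℝ)) (hA : ∀ e, A e 0 ≠ 0) :
    (0 : PairVec K) ∈ (queueStep M W A 0).support := by
  obtain ⟨a, ha⟩ := M.availLaw.support_nonempty
  obtain ⟨w, hw⟩ := (W 0 a).support_nonempty
  exact mem_support_queueStep.2 ⟨a, ha, w, hw, _, fun e => self_mem_support_binomialLaw _ (hq e),
    0, hA, by funext e; simp⟩

theorem irreducibleAperiodic_queueStep (hq : ∀ e : Pair K, 0 < (M.q e : ℝ))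
    (hT : ∀ i : Fin K, M.purifiedLaw i 0 ≠ 1) (hW : IsMaxWeight M W) (hA : ∀ e, A e 0 ≠ 0) :
    IrreducibleAperiodic (queueStep M W A) := by
  -- The empty state can be held for a further slot, so every time from `∑ e, x e` on is possible.
  have key : ∀ (n : ℕ) (x : PairVec K), ∑ e, x e ≤ n →
      (0 : PairVec K) ∈ (lawAt (queueStep M W A) (PMF.pure x) n).support := by
    intro n
    induction n with
    | zero =>
      intro x hx
      rw [lawAt, PMF.mem_support_pure_iff]
      funext e
      exact (Finset.sum_eq_zero_iff.1 (Nat.le_zero.1 hx) e (Finset.mem_univ e)).symm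
    | succ n ih =>
      intro x hx
      rw [lawAt_pure_succ, PMF.mem_support_bind_iff]
      by_cases h0 : x = 0
      · subst h0
        exact ⟨0, zero_mem_support_queueStep hq hA, ih 0 (by simp)⟩
      · obtain ⟨u, hu, hlt⟩ := exists_mem_support_queueStep_sum_lt hq hT hW hA h0
        exact ⟨u, hu, ih u (by omega)⟩
  refine ⟨0, fun x => ?_⟩
  filter_upwards [eventually_ge_atTop (∑ e, x e)] with n hn
  exact (PMF.apply_pos_iff _ _).2 (key n x hn)

/-- Every rate vector is the rate vector of arrivals with finite second moments that vanish with
positive probability. -/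
theorem exists_arrivals (lam : Pair K → ℝ≥0) :
    ∃ A : Pair K → PMF ℕ, HasRates A lam ∧ FiniteSecondMoments A ∧ ∀ e, A e 0 ≠ 0 := by
  -- Binomial arrivals with `N` trials and success probability `lam / N`; the strict inequality `lam
  -- < N` gives zero arrivals positive probability.
  set N : Pair K → ℕ := fun e => ⌈(lam e : ℝ)⌉₊ + 1
  have hN : ∀ e, (lam e : ℝ) < N e := fun e => by
    push_cast [N]
    linarith [Nat.le_ceil (lam e : ℝ)]
  have hN0 : ∀ e, (0 : ℝ) < N e := fun e => (NNReal.coe_nonneg _).trans_lt (hN e)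
  set p : Pair K → unitInterval := fun e => ⟨(lam e : ℝ) / N e,
    div_nonneg (NNReal.coe_nonneg _) (hN0 e).le, ((div_lt_one (hN0 e)).2 (hN e)).le⟩
  have hm : ∀ e, (binomialLaw (N e) (p e)).toMeasure = binomial (N e) (p e) := fun e =>
    Measure.toPMF_toMeasure _
  have hint : ∀ e (f : ℕ → ℝ), Integrable f (binomialLaw (N e) (p e)).toMeasure := fun e f => by
    rw [hm]; exact integrable_binomial f
  refine ⟨fun e => binomialLaw (N e) (p e), fun e => ⟨hint e _, ?_⟩, fun e => ?_, fun e => ?_⟩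
  · have h1 := ofReal_integral_eq_lintegral_ofReal (hint e fun k => (k : ℝ))
      (ae_of_all _ fun k => Nat.cast_nonneg k)
    simp only [lintegral_toMeasure, ENNReal.ofReal_natCast, expect_binomialLaw] at h1
    rw [ENNReal.ofReal_eq_ofReal_iff (integral_nonneg fun k => Nat.cast_nonneg k)
      (mul_nonneg (p e).2.1 (hN0 e).le)] at h1
    rw [h1]
    exact div_mul_cancel₀ _ (hN0 e).ne'
  · exact (memLp_two_iff_integrable_sq
      (measurable_of_countable _).aestronglyMeasurable).2 (hint e _)
  · exact zero_mem_support_binomialLaw _ ((div_lt_one (hN0 e)).2 (hN e))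

end CapacityRegion

end QSwitch

end

open QSwitch in
theorem theorem2 {K : ℕ} (M : Switch K)
    (hq : ∀ e : Pair K, 0 < (M.q e : ℝ))
    (hT : ∀ i : Fin K, M.purifiedLaw i 0 ≠ 1)
    (W : Policy K) (hW : IsMaxWeight M W) :
    (∀ (A : Pair K → PMF ℕ) (lam : Pair K → ℝ≥0), HasRates A lam → Admissible M W A →
      (Stable M W A ↔ lam ∈ LambdaPS M)) ∧
    capacityRegion M W = LambdaPS M ∧
    (∀ A : Pair K → PMF ℕ, (∀ e, A e 0 ≠ 0) → IrreducibleAperiodic (queueStep M W A)) := by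
  have hiff : ∀ (A : Pair K → PMF ℕ) (lam : Pair K → ℝ≥0), HasRates A lam → Admissible M W A →
      (Stable M W A ↔ lam ∈ LambdaPS M) := fun A lam h hA =>
    ⟨mem_LambdaPS_of_stable hq hT hW h hA.2, stable_of_mem_LambdaPS hq hT hW h hA⟩
  refine ⟨hiff, Set.Subset.antisymm (fun lam hlam => ?_) fun lam hlam A h hA =>
    (hiff A lam h hA).2 hlam, fun A hA => irreducibleAperiodic_queueStep hq hT hW hA⟩
  -- Membership in the capacity region quantifies over admissible arrivals, so one admissible
  -- example with these rates is needed to extract information from it.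
  obtain ⟨A, h, h2, h0⟩ := exists_arrivals lam
  have hadm : Admissible M W A := ⟨h2, irreducibleAperiodic_queueStep hq hT hW h0⟩
  exact (hiff A lam h hadm).1 (hlam A h hadm)
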